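/- Let $L>0$ and $0\le\beta<\frac{U-L}{2}$, and let $$\alpha=\left[W\!\left(\left(\tfrac{2\beta}{U}+\tfrac{L}{U}-1\right)e^{\frac{2\beta}{U}-1}\right)-\tfrac{2\beta}{U}+1\right]^{-1},$$ where $W$ is the principal branch of the Lambert function. **The problems.** An instance is a finite sequence of costs $f_1,\dots,f_T$. A solution is a sequence of decisions $x_1,\dots,x_T$ with $\sum_{t=1}^T c(x_t)\ge 1$; its cost is $\sum_{t=1}^T f_t(x_t)+\sum_{t=1}^{T+1}d(x_{t-1},x_t)$, where $x_0=x_{T+1}=o$ is a fixed start. $\mathrm{OPT}$ is the infimum of the costs of all solutions, and instances are required to have a solution. A deterministic online algorithm chooses $x_t$ as a function of $T$ and $f_1,\dots,f_t$, and produces a solution on every instance of the problem with the given parameters and weights. Its competitive ratio on a set of instances is the supremum of $\mathrm{ALG}/\mathrm{OPT}$ over that set. - CFL (convex function chasing with a long-term constraint), with weights $\mathbf w\ge 0$, $\mathbf c>0$ in $\mathbb R^d$ and $\beta=\max_i \mathbf w^i/\mathbf c^i$: decisions are the $x\in[0,1]^d$ with $c(x):=\sum_i\mathbf c^i|x^i|\le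 1$; $o=0$; $d(x,y)=\sum_i\mathbf w^i|x^i-y^i|$; each $f_t$ is convex and differentiable with $f_t(0)=0$ and $L\le[\nabla f_t]^i/\mathbf c^i\le U$ for all $i$. - MAL (online metric allocation with a long-term constraint), on a weighted star, i.e. a finite point set with edge weights $\mathbf w\ge0$ and distances $\mathbf w^a+\mathbf w^b$ between distinct points $a,b$, with a distinguished OFF point $a'$ and $\beta$ the largest distance of a point from $a'$: decisions are the probability vectors on the points; $o$ is the unit mass at $a'$; $d(x,y)$ is the optimal transport cost from $x$ to $y$ for the star metric; $c(x)=\sum_a\mathbf c^ax^a$ with $\mathbf c^a\in[0,1]$, $\mathbf c^{a'}=0$; $f_t(x)=\sum_af_t^a(x^a)$ with $f_t^{a'}=0$ on $[0,1]$ and, for $a\ne a'$, $f_t^a$ convex and differentiable on $[0,1]$ with $f_t^a(0)=0$ and derivative in $[L,U]$. **The lower-bound instances.** Fix $d\ge1$, weights $\mathbf w\in\mathbb R_{\ge0}^d$ with $\max_i\mathbf w^i=\mathbf w^k=\beta$, and $\mathbf c=(1,\dots,1)$. For positive integers $w,m$ put $\delta=(U-L)/w$. Write $\mathrm{Up}$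 for the price $U$ and $\mathrm{Down}^i$ for the price $U-i\delta$. A price sequence of type $(w,m)$ is determined by some $w_y\in\{0,\dots,w\}$, $y=U-w_y\delta$ and $\varepsilon\in[0,\delta]$ with $y+\varepsilon\le U$. It consists of a finite sequence of prices $\mathrm{Up}$ and $\mathrm{Down}^i$, $1\le i\le w_y$, in which the indices $i$ of the Down prices do not decrease and each $\mathrm{Down}^i$ occurs at most $m$ times; then exactly $m$ times the price $y+\varepsilon$; then at least $m$ times $\mathrm{Up}$. A price $p$ stands for the CFL cost function $\sum_{j\ne k}Ux^j+p\,x^k$. For $N\in\mathbb N$ let $\mathcal F_N$ be the set of all sequences of CFL cost functions given by price sequences of types $(w,m)$ with $w,m\ge N$. Let $\mathcal F_N'$ be the corresponding set for MAL on the weighted star with points $a',1,\dots,d$, edge weights $0,\mathbf w^1,\dots,\mathbf w^d$, and $\mathbf c^{a'}=0$, $\mathbf c^a=1$ for $a\neq a'$, where the price $p$ stands for the costs $f^{a'}=0$, $f^k(s)=ps$ and $f^a(s)=Us$ for $a\ne a',k$. **Statement.** For every $N$: 1. Every sequence in $\mathcal F_N$ is an instance of CFL, and the sequence in $\mathcal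 F'_N$ with the same prices is an instance of MAL, with the parameters $L,U,\beta$ and the weights above. The two correspond to each other: the map that forgets the coordinate of $a'$ is a bijection from the MAL decisions onto the CFL decisions which preserves the start, the switching costs, the constraint function and all the hitting costs $f_t$. 2. Every deterministic online algorithm for CFL has competitive ratio at least $\alpha$ on $\mathcal F_N$. 3. Every deterministic online algorithm for MAL has competitive ratio at least $\alpha$ on $\mathcal F_N'$. -/

import Mathlib

open scoped ENNReal

noncomputable section

/-! ## The competitive ratio `α` -/

/-- The principal branch of the Lambert function: for `x ≥ -1/e`, the unique `v ≥ -1` with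
`v * exp v = x`. -/
def lambertW (x : ℝ) : ℝ :=
  Function.invFunOn (fun v : ℝ => v * Real.exp v) (Set.Ici (-1)) x

/-- `α = [W((2β/U + L/U - 1) e^{2β/U - 1}) - 2β/U + 1]⁻¹`. -/
def alphaRatio (L U β : ℝ) : ℝ :=
  (lambertW ((2 * β / U + L / U - 1) * Real.exp (2 * β / U - 1)) - 2 * β / U + 1)⁻¹

/-! ## Online problems with a long-term constraint

An instance of a problem is the finite list `I` of its revealed costs; its horizon is the length
`T` of the list. -/

/-- The fixed data of an online problem with hitting costs, switching costs and a long-term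
constraint. `K` is the type of the costs that are revealed one at a time, and decisions are
elements of `decisions ⊆ E`. -/
structure OnlineProblem (K E : Type*) where
  /-- the decisions the player may take -/
  decisions : Set E
  /-- the state in which the player starts, and in which the player has to end -/
  start : E
  /-- the hitting cost of a decision under a revealed cost -/
  hit : K → E → ℝ
  /-- the switching cost between two consecutive states -/
  move : E → E → ℝ
  /-- the part of the long-term constraint satisfied by a decision -/
  con : E → ℝ

namespace OnlineProblem

variable {K E : Type*} (P : OnlineProblem K E)

/-- The states `x_0 = start, x_1, …, x_T, x_{T+1} = start` belonging to decisions
`x_1, …, x_T`. -/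
def state {T : ℕ} (x : Fin T → E) (t : ℕ) : E :=
  if h : 0 < t ∧ t ≤ T then x ⟨t - 1, by omega⟩ else P.start

/-- The total cost `∑_{t=1}^{T} f_t(x_t) + ∑_{t=1}^{T+1} move(x_{t-1}, x_t)`. -/
def cost (I : List K) (x : Fin I.length → E) : ℝ :=
  (∑ t, P.hit (I.get t) (x t)) +
    ∑ t ∈ Finset.range (I.length + 1), P.move (P.state x t) (P.state x (t + 1))

/-- All decisions are admissible and the long-term constraint `∑_t c(x_t) ≥ 1` is satisfied. -/
def Feasible (I : List K) (x : Fin I.length → E) : Prop :=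
  (∀ t, x t ∈ P.decisions) ∧ 1 ≤ ∑ t, P.con (x t)

/-- The offline optimal cost of an instance. -/
def opt (I : List K) : ℝ :=
  sInf {r | ∃ x : Fin I.length → E, P.Feasible I x ∧ r = P.cost I x}

end OnlineProblem

/-- A deterministic online algorithm: given the horizon `T` and the list of the costs
`f_1, …, f_t` revealed so far, it returns its decision `x_t`. -/
def OnlineAlgorithm (K E : Type*) : Type _ := ℕ → List K → E

namespace OnlineAlgorithm

variable {K E : Type*} (A : OnlineAlgorithm K E) (P : OnlineProblem K E)

/-- The decisions of the algorithm on an instance. -/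
def run (I : List K) (t : Fin I.length) : E := A I.length (I.take (t + 1))

/-- The algorithm solves the problem on the input set `Ω`: its decisions are feasible on every
instance of `Ω`. -/
def Solves (Ω : Set (List K)) : Prop := ∀ I ∈ Ω, P.Feasible I (A.run I)

/-- The competitive ratio `sup_{I ∈ Ω} ALG(I) / OPT(I)` over the input set `Ω`. -/
def competitiveRatio (Ω : Set (List K)) : ℝ≥0∞ :=
  ⨆ I ∈ Ω, ENNReal.ofReal (P.cost I (A.run I)) / ENNReal.ofReal (P.opt I)

end OnlineAlgorithm

/-- Under `Φ`, the instance `I` of `P` and the instance `J` of `Q` are the same: `Φ` is a bijection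
of the decisions which preserves the start, the switching costs, the constraint function and every
hitting cost. -/
def Corresponds {K E K' E' : Type*} (P : OnlineProblem K E) (Q : OnlineProblem K' E')
    (Φ : E → E') (I : List K) (J : List K') : Prop :=
  Set.BijOn Φ P.decisions Q.decisions ∧
  Φ P.start = Q.start ∧
  (∀ x ∈ P.decisions, ∀ y ∈ P.decisions, Q.move (Φ x) (Φ y) = P.move x y) ∧
  (∀ x ∈ P.decisions, Q.con (Φ x) = P.con x) ∧
  List.Forall₂ (fun f g => ∀ x ∈ P.decisions, Q.hit g (Φ x) = P.hit f x) I J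

/-! ## Convex function chasing with a long-term constraint (CFL) -/

section CFL

variable {ι : Type*} [Fintype ι]

/-- CFL with switching weights `w` and constraint weights `c`: decisions are the points of
`[0,1]^d` in the unit ball of the norm `‖·‖_{ℓ₁(c)}`, the player starts and ends at the origin,
switching costs are distances in `‖·‖_{ℓ₁(w)}`, and `c(x) = ‖x‖_{ℓ₁(c)}`. -/
def cflProblem (w c : ι → ℝ) : OnlineProblem ((ι → ℝ) → ℝ) (ι → ℝ) where
  decisions := {x | (∀ i, x i ∈ Set.Icc (0 : ℝ) 1) ∧ ∑ i, c i * |x i| ≤ 1}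
  start := 0
  hit f x := f x
  move x y := ∑ i, w i * |x i - y i|
  con x := ∑ i, c i * |x i|

/-- Admissible cost functions of CFL: convex, zero at the origin, and with
`L ≤ [∇f]^i / c^i ≤ U` in every coordinate `i`. -/
def IsCFLCost [DecidableEq ι] (L U : ℝ) (w c : ι → ℝ) (f : (ι → ℝ) → ℝ) : Prop :=
  ConvexOn ℝ (cflProblem w c).decisions f ∧ f 0 = 0 ∧
  ∀ x ∈ (cflProblem w c).decisions, ∃ f' : (ι → ℝ) →L[ℝ] ℝ,
    HasFDerivWithinAt f f' (cflProblem w c).decisions x ∧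
    ∀ i, f' (Pi.single i 1) / c i ∈ Set.Icc L U

/-- The CFL instances with parameters `L`, `U`, `β` for given weights `w`, `c`, where
`β = max_i w^i / c^i`, and a feasible solution exists. -/
def cflInstances [DecidableEq ι] (L U β : ℝ) (w c : ι → ℝ) : Set (List ((ι → ℝ) → ℝ)) :=
  {I | (∀ i, 0 ≤ w i) ∧ (∀ i, 0 < c i) ∧ IsGreatest (Set.range fun i => w i / c i) β ∧
    (∀ f ∈ I, IsCFLCost L U w c f) ∧ ∃ x, (cflProblem w c).Feasible I x}

end CFL

/-! ## Online metric allocation with a long-term constraint on weighted stars (MAL) -/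

section MAL

variable {X : Type*} [Fintype X] [DecidableEq X]

/-- The metric of the weighted star whose leaf `a` is joined to the interior vertex by an edge of
weight `w a`. -/
def starDist (w : X → ℝ) (a b : X) : ℝ := if a = b then 0 else w a + w b

/-- The cost of changing the allocation `x` to the allocation `y` when moving one unit of the
resource from `a` to `b` costs `d a b`: the least cost of a transport plan. -/
def transportCost (d : X → X → ℝ) (x y : X → ℝ) : ℝ :=
  sInf {r | ∃ γ : X → X → ℝ, (∀ a b, 0 ≤ γ a b) ∧ (∀ a, ∑ b, γ a b = x a) ∧
    (∀ b, ∑ a, γ a b = y b) ∧ r = ∑ a, ∑ b, d a b * γ a b}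

/-- MAL on the star with edge weights `w`, OFF point `off` and constraint weights `c`: decisions
are allocations of a unit resource to the points, the player starts and ends with everything at the
OFF point, revealed costs are families `(f^a)_a` of functions with `f(x) = ∑_a f^a(x^a)`, and
`c(x) = ∑_a c^a x^a`. -/
def malProblem (w : X → ℝ) (off : X) (c : X → ℝ) : OnlineProblem (X → ℝ → ℝ) (X → ℝ) where
  decisions := stdSimplex ℝ X
  start := Pi.single off 1
  hit f x := ∑ a, f a (x a)
  move x y := transportCost (starDist w) x y
  con x := ∑ a, c a * x a

/-- Admissible costs of MAL: no cost at the OFF point; at every other point a convex function on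
`[0,1]` which is zero at `0` and has its derivative in `[L, U]`. -/
def IsMALCost (L U : ℝ) (off : X) (f : X → ℝ → ℝ) : Prop :=
  (∀ s ∈ Set.Icc (0 : ℝ) 1, f off s = 0) ∧
  ∀ a, a ≠ off → ConvexOn ℝ (Set.Icc 0 1) (f a) ∧ f a 0 = 0 ∧
    ∀ s ∈ Set.Icc (0 : ℝ) 1, ∃ f' ∈ Set.Icc L U, HasDerivWithinAt (f a) f' (Set.Icc 0 1) s

/-- The MAL instances with parameters `L`, `U`, `β` on a given weighted star, where `β` is the
greatest distance of a point from the OFF point, and a feasible solution exists. -/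
def malInstances (L U β : ℝ) (w : X → ℝ) (off : X) (c : X → ℝ) : Set (List (X → ℝ → ℝ)) :=
  {I | (∀ a, 0 ≤ w a) ∧ (∀ a, c a ∈ Set.Icc (0 : ℝ) 1) ∧ c off = 0 ∧
    IsGreatest (Set.range fun a => starDist w off a) β ∧
    (∀ f ∈ I, IsMALCost L U off f) ∧ ∃ x, (malProblem w off c).Feasible I x}

end MAL

/-! ## The lower-bound instances -/

/-- The sequences of prices (cost coefficients in the direction `k` of largest weight) of the
lower-bound instances with `w, m ≥ N`. With `δ = (U - L) / w`, level `i` stands for the price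
`U - i δ`, so that level `0` is "Up" and level `i ≥ 1` is "Down^i". A sequence starts with Up and
Down prices in which the Down levels do not decrease, each of them presented at most `m` times, and
do not exceed `wy`. With `y = U - wy δ`, it goes on with `m` times the price `y + ε`, and ends with
a batch of at least `m` times Up. -/
def lowerBoundPrices (L U : ℝ) (N : ℕ) : Set (List ℝ) :=
  {p | ∃ (w m wy m' : ℕ) (δ y ε : ℝ) (levels : List ℕ),
    0 < w ∧ N ≤ w ∧ 0 < m ∧ N ≤ m ∧ m ≤ m' ∧ wy ≤ w ∧
    δ = (U - L) / w ∧ y = U - wy * δ ∧ 0 ≤ ε ∧ ε ≤ δ ∧ y + ε ≤ U ∧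
    (∀ i ∈ levels, i ≤ wy) ∧
    levels.Pairwise (fun i j => i ≠ 0 → j ≠ 0 → i ≤ j) ∧
    (∀ i, i ≠ 0 → levels.count i ≤ m) ∧
    p = levels.map (fun i : ℕ => U - i * δ) ++ List.replicate m (y + ε) ++ List.replicate m' U}

section LowerBound

variable {ι : Type*} [Fintype ι] [DecidableEq ι]

/-- The CFL cost function `∑_{j ≠ k} U x^j + p x^k`. -/
def cflPriceCost (U : ℝ) (k : ι) (p : ℝ) (x : ι → ℝ) : ℝ :=
  (∑ j ∈ Finset.univ.erase k, U * x j) + p * x k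

/-- The MAL costs `f^k(s) = p s` and `f^a(s) = U s` for the other points `a` except the OFF point
`none`, where the cost is zero. -/
def malPriceCost (U : ℝ) (k : ι) (p : ℝ) : Option ι → ℝ → ℝ
  | none, _ => 0
  | some j, s => if j = k then p * s else U * s

/-- Edge weights of the star on the points `Option ι`: the OFF point `none` is joined to the
interior vertex by an edge of weight `0`, the point `some i` by an edge of weight `w i`. -/
def starWeight (w : ι → ℝ) : Option ι → ℝ
  | none => 0
  | some i => w i

/-- Constraint weights on the star: `0` at the OFF point and `1` at all other points. -/
def starCon : Option ι → ℝ
  | none => 0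
  | some _ => 1

/-- The linear map that forgets the coordinate of the OFF point. -/
def forgetOff (x : Option ι → ℝ) (i : ι) : ℝ := x (some i)

end LowerBound

end

noncomputable section

/-! ## The instances and the transfer between MAL and CFL -/

section Transport

variable {X : Type*} [Fintype X] [DecidableEq X]

/-! The constant `α` is the one for which `α (log (U - L - 2β) - log (U - 2β - U/α)) = 1`
(`alphaRatio_spec`), the balance of a game in which the price sinks from `U` to `L`. Let `V` be the
amount bought so far and `F` the saving compared with paying `U` for all of it. If the adversary
stops at the price `y`, then OPT is about `y` (`cfl_opt_le`), so a `ρ`-competitive player who buys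
little in the final batch needs `F ≥ U max(1, V) - ρ y`, up to errors, before it starts
(`savings_ge`). On the other hand a unit bought near the price `y` saves only about `u = U - y -
2β`, because the adversary makes the player pay for moving in and out. With `R = U - α y` the
potential `V - (F - R)/u` is unaffected by purchases at the current rate and gains about `α du/u` as
the price sinks. It starts near `0` where `R` becomes nonnegative, cannot exceed `1` at the end, and
gains `1` in between; the gap `α - ρ` leaves a margin that covers all errors and gives the
contradiction (`no_savings`).

Switching is forced as follows. If the player would buy much during `m` equal Down prices, some
single decision dominates all earlier ones of the batch (`exists_dominating`). The adversary then
shows Up until the player has withdrawn, so almost every unit bought has paid `2β`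
(`exists_interrupt`). Total purchases are bounded, so this cannot happen at too many levels in a
row, and a level where stopping hurts appears soon (`exists_quiet_level`).

For MAL, the OFF point has edge weight `0` and transport on a star is a weighted `ℓ₁` distance, so
forgetting the OFF coordinate turns MAL decisions into CFL decisions of equal cost
(`corresponds_map`). -/

lemma sum_starDist_mul (w : X → ℝ) (γ : X → X → ℝ) :
    ∑ a, ∑ b, starDist w a b * γ a b =
      ∑ a, w a * ((∑ b, γ a b - γ a a) + (∑ b, γ b a - γ a a)) := by
  -- The distance is `w a + w b` except on the diagonal, where `2 * w a` has to be taken off again.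
  have h1 : ∀ a b, starDist w a b * γ a b =
      w a * γ a b + w b * γ a b - if a = b then 2 * w a * γ a a else 0 := by
    intro a b
    unfold starDist
    split_ifs with h
    · subst h; ring
    · ring
  simp_rw [h1, Finset.sum_sub_distrib, Finset.sum_add_distrib]
  rw [Finset.sum_comm (f := fun a b => w b * γ a b)]
  simp only [Finset.sum_ite_eq, Finset.mem_univ, if_true]
  rw [← Finset.sum_add_distrib, ← Finset.sum_sub_distrib]
  refine Finset.sum_congr rfl fun a _ => ?_
  rw [← Finset.mul_sum, ← Finset.mul_sum]
  ring

/-- The optimal transport cost on a weighted star is a weighted `ℓ₁` distance. -/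
lemma transportCost_starDist {w x y : X → ℝ} (hw : ∀ a, 0 ≤ w a) (hx : x ∈ stdSimplex ℝ X)
    (hy : y ∈ stdSimplex ℝ X) :
    transportCost (starDist w) x y = ∑ a, w a * |x a - y a| := by
  have key : IsLeast {r | ∃ γ : X → X → ℝ, (∀ a b, 0 ≤ γ a b) ∧ (∀ a, ∑ b, γ a b = x a) ∧
    (∀ b, ∑ a, γ a b = y b) ∧ r = ∑ a, ∑ b, starDist w a b * γ a b}
      (∑ a, w a * |x a - y a|) := by
    constructor
    · set M := ∑ a, max (x a - y a) 0 with hM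
      have hM' : M = ∑ a, max (y a - x a) 0 := by
        rw [← sub_eq_zero, hM, ← Finset.sum_sub_distrib]
        have : ∀ a, max (x a - y a) 0 - max (y a - x a) 0 = x a - y a := by
          intro a
          rcases le_total (x a) (y a) with h | h
          · rw [max_eq_right (by linarith), max_eq_left (by linarith)]; ring
          · rw [max_eq_left (by linarith), max_eq_right (by linarith)]; ring
        simp_rw [this, Finset.sum_sub_distrib, hx.2, hy.2, sub_self]
      have hM0 : 0 ≤ M := Finset.sum_nonneg fun a _ => le_max_right _ _
      have hz : M = 0 → ∀ a, max (x a - y a) 0 = 0 := fun h a =>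
        (Finset.sum_eq_zero_iff_of_nonneg fun a _ => le_max_right _ _).1 (hM.symm.trans h) a
          (Finset.mem_univ a)
      have hz' : M = 0 → ∀ a, max (y a - x a) 0 = 0 := fun h a =>
        (Finset.sum_eq_zero_iff_of_nonneg fun a _ => le_max_right _ _).1 (hM'.symm.trans h) a
          (Finset.mem_univ a)
      have hmin : ∀ a, min (x a) (y a) + max (x a - y a) 0 = x a := by
        intro a
        rcases le_total (x a) (y a) with h | h
        · rw [max_eq_right (by linarith), min_eq_left h]; ring
        · rw [max_eq_left (by linarith), min_eq_right h]; ring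
      have hmin' : ∀ a, min (x a) (y a) + max (y a - x a) 0 = y a := by
        intro a
        rcases le_total (x a) (y a) with h | h
        · rw [max_eq_left (by linarith), min_eq_left h]; ring
        · rw [max_eq_right (by linarith), min_eq_right h]; ring
      have hprod : ∀ a, max (x a - y a) 0 * max (y a - x a) 0 = 0 := by
        intro a
        rcases le_total (x a) (y a) with h | h
        · rw [max_eq_right (a := x a - y a) (by linarith), zero_mul]
        · rw [max_eq_right (a := y a - x a) (by linarith), mul_zero]
      -- The common mass stays put and each surplus is spread over the deficits in proportion. If `M
      -- = 0` there is nothing to move, and division by zero gives the right value `0`.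
      let γ : X → X → ℝ := fun a b =>
        (if a = b then min (x a) (y a) else 0) + max (x a - y a) 0 * max (y b - x b) 0 / M
      have hr : ∀ a, ∑ b, γ a b = x a := by
        intro a
        simp only [γ, Finset.sum_add_distrib, Finset.sum_ite_eq, Finset.mem_univ, if_true]
        rw [← Finset.sum_div, ← Finset.mul_sum, ← hM']
        by_cases h : M = 0
        · have h1 := hmin a
          rw [hz h a] at h1 ⊢
          simpa using h1
        · rw [mul_div_cancel_right₀ _ h]; exact hmin a
      have hc : ∀ b, ∑ a, γ a b = y b := by
        intro b
        simp only [γ, Finset.sum_add_distrib, Finset.sum_ite_eq', Finset.mem_univ, if_true]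
        rw [← Finset.sum_div, ← Finset.sum_mul, ← hM]
        by_cases h : M = 0
        · have h1 := hmin' b
          rw [hz' h b] at h1 ⊢
          simpa using h1
        · rw [mul_div_cancel_left₀ _ h]; exact hmin' b
      refine ⟨γ, ?_, hr, hc, ?_⟩
      · intro a b
        have h1 := hx.1 a
        have h2 := hy.1 a
        simp only [γ]
        split_ifs <;> positivity
      · rw [sum_starDist_mul]
        refine Finset.sum_congr rfl fun a _ => ?_
        rw [hr a, hc a]
        simp only [γ, if_true, hprod, zero_div, add_zero]
        congr 1
        rcases le_total (x a) (y a) with h | h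
        · rw [min_eq_left h, abs_of_nonpos (by linarith)]; ring
        · rw [min_eq_right h, abs_of_nonneg (by linarith)]; ring
    · rintro r ⟨γ, h0, hr, hc, rfl⟩
      rw [sum_starDist_mul]
      refine Finset.sum_le_sum fun a _ => mul_le_mul_of_nonneg_left ?_ (hw a)
      -- At most `min (x a) (y a)` can stay at `a`; all other mass leaves or enters along the edge
      -- of `a`.
      have h1 : γ a a ≤ x a := by
        rw [← hr a]
        exact Finset.single_le_sum (f := γ a) (fun b _ => h0 a b) (Finset.mem_univ a)
      have h2 : γ a a ≤ y a := by
        rw [← hc a]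
        exact Finset.single_le_sum (f := fun b => γ b a) (fun b _ => h0 b a) (Finset.mem_univ a)
      rw [hr a, hc a, abs_le]
      constructor <;> linarith
  exact key.csInf_eq

end Transport

/-! ### Admissibility of the instances and the bijection of decisions -/

section Instances

variable {ι : Type*}

lemma price_mem_Icc {L U : ℝ} (hLU : L ≤ U) {w i : ℕ} (hw : 0 < w) (hi : i ≤ w) :
    U - i * ((U - L) / w) ∈ Set.Icc L U := by
  have hw' : (0 : ℝ) < w := by exact_mod_cast hw
  have h1 : (i : ℝ) * ((U - L) / w) ≤ U - L := by
    rw [← mul_div_assoc, div_le_iff₀ hw', mul_comm]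
    exact mul_le_mul_of_nonneg_left (by exact_mod_cast hi) (by linarith)
  have h2 : 0 ≤ (i : ℝ) * ((U - L) / w) := by
    have : 0 ≤ U - L := by linarith
    positivity
  constructor <;> linarith

lemma mem_Icc_of_mem_lowerBoundPrices {L U : ℝ} (hLU : L ≤ U) {N : ℕ} {p : List ℝ}
    (hp : p ∈ lowerBoundPrices L U N) : p ≠ [] ∧ ∀ c ∈ p, c ∈ Set.Icc L U := by
  obtain ⟨w, m, wy, m', δ, y, ε, levels, hw, -, hm, -, hmm, hwy, rfl, rfl, h0, h1, h2, hl, -, -,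
    rfl⟩ := hp
  constructor
  · intro h
    have := congrArg List.length h
    simp at this
    omega
  · intro c hc
    rw [List.mem_append, List.mem_append] at hc
    rcases hc with (hc | hc) | hc
    · obtain ⟨i, hi, rfl⟩ := List.mem_map.1 hc
      exact price_mem_Icc hLU hw ((hl i hi).trans hwy)
    · rw [List.eq_of_mem_replicate hc]
      exact ⟨by linarith [(price_mem_Icc hLU hw hwy).1], h2⟩
    · rw [List.eq_of_mem_replicate hc]
      exact ⟨hLU, le_rfl⟩

lemma cflPriceCost_eq_sum [Fintype ι] [DecidableEq ι] (U : ℝ) (k : ι) (p : ℝ) (x : ι → ℝ) :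
    cflPriceCost U k p x = ∑ i, (if i = k then p else U) * x i := by
  rw [cflPriceCost, ← Finset.sum_erase_add _ _ (Finset.mem_univ k)]
  congr 1
  · refine Finset.sum_congr rfl fun i hi => ?_
    rw [if_neg (Finset.ne_of_mem_erase hi)]
  · rw [if_pos rfl]

lemma convex_cflDecisions [Fintype ι] (w c : ι → ℝ) (hc : ∀ i, 0 ≤ c i) :
    Convex ℝ (cflProblem w c).decisions := by
  intro x hx y hy s t hs ht hst
  refine ⟨fun i => convex_Icc (0 : ℝ) 1 (hx.1 i) (hy.1 i) hs ht hst, ?_⟩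
  calc ∑ i, c i * |(s • x + t • y) i| ≤ ∑ i, (s * (c i * |x i|) + t * (c i * |y i|)) := by
        refine Finset.sum_le_sum fun i _ => ?_
        have h1 : |(s • x + t • y) i| ≤ s * |x i| + t * |y i| := by
          simp only [Pi.add_apply, Pi.smul_apply, smul_eq_mul]
          refine (abs_add_le _ _).trans ?_
          rw [abs_mul, abs_mul, abs_of_nonneg hs, abs_of_nonneg ht]
        nlinarith [mul_le_mul_of_nonneg_left h1 (hc i)]
    _ ≤ 1 := by
        rw [Finset.sum_add_distrib, ← Finset.mul_sum, ← Finset.mul_sum]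
        nlinarith [mul_le_mul_of_nonneg_left hx.2 hs, mul_le_mul_of_nonneg_left hy.2 ht]

lemma isCFLCost_cflPriceCost [Fintype ι] [DecidableEq ι] {L U : ℝ} (w : ι → ℝ) (k : ι)
    {p : ℝ} (hp : p ∈ Set.Icc L U) : IsCFLCost L U w (fun _ => 1) (cflPriceCost U k p) := by
  let φ : (ι → ℝ) →L[ℝ] ℝ :=
    ∑ i, (if i = k then p else U) • ContinuousLinearMap.proj (R := ℝ) (φ := fun _ : ι => ℝ) i
  have hφ : ∀ x, φ x = cflPriceCost U k p x := by
    intro x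
    rw [cflPriceCost_eq_sum]
    simp only [φ, sum_apply, smul_apply, ContinuousLinearMap.proj_apply,
      smul_eq_mul]
  have hφ' : cflPriceCost U k p = φ := funext fun x => (hφ x).symm
  refine ⟨?_, by rw [hφ', map_zero], fun x _ => ⟨φ, ?_, fun i => ?_⟩⟩
  · rw [hφ']
    exact φ.toLinearMap.convexOn (convex_cflDecisions w _ fun _ => zero_le_one)
  · rw [hφ']
    exact φ.hasFDerivWithinAt
  · rw [div_one, hφ, cflPriceCost_eq_sum]
    simp only [Pi.single_apply, mul_ite, mul_one, mul_zero, Finset.sum_ite_eq', Finset.mem_univ,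
      if_true]
    split_ifs
    · exact hp
    · exact ⟨hp.1.trans hp.2, le_rfl⟩

lemma isMALCost_malPriceCost [DecidableEq ι] {L U : ℝ} (k : ι) {p : ℝ} (hp : p ∈ Set.Icc L U) :
    IsMALCost L U none (malPriceCost U k p) := by
  refine ⟨fun s _ => rfl, fun a ha => ?_⟩
  obtain ⟨j, rfl⟩ := Option.ne_none_iff_exists'.1 ha
  obtain ⟨q, hq, hqf⟩ : ∃ q ∈ Set.Icc L U, malPriceCost U k p (some j) = fun s => q * s := by
    by_cases h : j = k
    · exact ⟨p, hp, by funext s; simp [malPriceCost, h]⟩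
    · exact ⟨U, ⟨hp.1.trans hp.2, le_rfl⟩, by funext s; simp [malPriceCost, h]⟩
  rw [hqf]
  refine ⟨((LinearMap.mul ℝ ℝ) q).convexOn (convex_Icc 0 1), mul_zero q, fun s _ => ⟨q, hq, ?_⟩⟩
  simpa using ((hasDerivAt_id s).const_mul q).hasDerivWithinAt

lemma map_mem_cflInstances [Fintype ι] [DecidableEq ι] {L U β : ℝ} {w : ι → ℝ}
    (hw : ∀ i, 0 ≤ w i) {k : ι} (hk : ∀ i, w i ≤ w k) (hkβ : w k = β) {p : List ℝ} (hp : p ≠ [])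
    (hpI : ∀ c ∈ p, c ∈ Set.Icc L U) :
    p.map (cflPriceCost U k) ∈ cflInstances L U β w (fun _ => 1) := by
  refine ⟨hw, fun _ => one_pos, ⟨⟨k, by simp [hkβ]⟩, ?_⟩, ?_, fun _ => Pi.single k 1, ?_, ?_⟩
  · rintro _ ⟨i, rfl⟩
    simpa [← hkβ] using hk i
  · intro f hf
    obtain ⟨c, hc, rfl⟩ := List.mem_map.1 hf
    exact isCFLCost_cflPriceCost w k (hpI c hc)
  · intro t
    refine ⟨fun i => ?_, ?_⟩
    · by_cases h : i = k
      · subst h; simp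
      · simp [h]
    · simp [Pi.single_apply, apply_ite abs]
  · have : 1 ≤ p.length := List.length_pos_iff.2 hp
    simp only [cflProblem, Pi.single_apply, apply_ite abs]
    simpa using this

lemma map_mem_malInstances [Fintype ι] [DecidableEq ι] {L U β : ℝ} {w : ι → ℝ}
    (hw : ∀ i, 0 ≤ w i) {k : ι} (hk : ∀ i, w i ≤ w k) (hkβ : w k = β) {p : List ℝ} (hp : p ≠ [])
    (hpI : ∀ c ∈ p, c ∈ Set.Icc L U) :
    p.map (malPriceCost U k) ∈ malInstances L U β (starWeight w) none starCon := by
  refine ⟨?_, ?_, rfl, ⟨⟨some k, by simp [starDist, starWeight, hkβ]⟩, ?_⟩, ?_,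
    fun _ => Pi.single (some k) 1, fun _ => single_mem_stdSimplex ℝ _, ?_⟩
  · rintro (_ | i)
    exacts [le_rfl, hw i]
  · rintro (_ | i) <;> simp [starCon]
  · rintro _ ⟨_ | i, rfl⟩
    · simpa [starDist, ← hkβ] using hw k
    · simpa [starDist, starWeight, ← hkβ] using hk i
  · intro f hf
    obtain ⟨c, hc, rfl⟩ := List.mem_map.1 hf
    exact isMALCost_malPriceCost k (hpI c hc)
  · have : 1 ≤ p.length := List.length_pos_iff.2 hp
    simp only [malProblem, Pi.single_apply]
    simpa [starCon] using this

/-- The OFF coordinate is the slack `1 - ∑ x i` of the constraint, so it carries no information. -/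
lemma bijOn_forgetOff [Fintype ι] (w : ι → ℝ) :
    Set.BijOn forgetOff (stdSimplex ℝ (Option ι)) (cflProblem w fun _ => 1).decisions := by
  have hsum : ∀ x ∈ stdSimplex ℝ (Option ι), x none + ∑ i, x (some i) = 1 := by
    intro x hx
    rw [← Fintype.sum_option]
    exact hx.2
  refine ⟨fun x hx => ⟨fun i => ⟨hx.1 _, ?_⟩, ?_⟩, fun x hx y hy hxy => ?_, fun x hx => ?_⟩
  · rw [← hx.2]
    exact Finset.single_le_sum (fun a _ => hx.1 a) (Finset.mem_univ (some i))
  · have h1 := hsum x hx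
    have h2 := hx.1 none
    have h3 : ∀ i, (1 : ℝ) * |forgetOff x i| = x (some i) := fun i => by
      rw [one_mul]; exact abs_of_nonneg (hx.1 _)
    simp_rw [h3]
    linarith
  · have h0 : ∀ i, x (some i) = y (some i) := fun i => congrFun hxy i
    funext a
    rcases a with _ | i
    · have h1 := hsum x hx
      have h2 := hsum y hy
      simp_rw [h0] at h1
      linarith
    · exact h0 i
  · have h3 : ∑ i, x i ≤ 1 := by
      have := hx.2
      simp only [one_mul] at this
      calc ∑ i, x i = ∑ i, |x i| := Finset.sum_congr rfl fun i _ => (abs_of_nonneg (hx.1 i).1).symm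
        _ ≤ 1 := this
    refine ⟨fun a => a.elim (1 - ∑ i, x i) x, ⟨?_, ?_⟩, rfl⟩
    · rintro (_ | i)
      · simpa using h3
      · exact (hx.1 i).1
    · rw [Fintype.sum_option]
      simp

/-- The OFF point has edge weight, constraint weight and hitting cost zero, so its term drops out of
every sum. -/
lemma corresponds_map [Fintype ι] [DecidableEq ι] {w : ι → ℝ} (hw : ∀ i, 0 ≤ w i)
    (U : ℝ) (k : ι) (p : List ℝ) :
    Corresponds (malProblem (starWeight w) none starCon) (cflProblem w (fun _ => 1)) forgetOff
      (p.map (malPriceCost U k)) (p.map (cflPriceCost U k)) := by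
  refine ⟨bijOn_forgetOff w, ?_, fun x hx y hy => ?_, fun x hx => ?_, ?_⟩
  · funext i
    simp [malProblem, cflProblem, forgetOff]
  · have hw' : ∀ a, 0 ≤ starWeight w a := by
      rintro (_ | i)
      exacts [le_rfl, hw i]
    simp only [malProblem, transportCost_starDist hw' hx hy, Fintype.sum_option]
    simp [cflProblem, forgetOff, starWeight]
  · simp only [malProblem, cflProblem, Fintype.sum_option]
    simp only [starCon, forgetOff, zero_mul, zero_add]
    exact Finset.sum_congr rfl fun i _ => by rw [abs_of_nonneg (hx.1 _)]
  · rw [List.forall₂_map_left_iff, List.forall₂_map_right_iff, List.forall₂_same]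
    intro c _ x _
    simp only [malProblem, cflProblem, Fintype.sum_option, cflPriceCost_eq_sum]
    simp only [malPriceCost, forgetOff, zero_add]
    exact Finset.sum_congr rfl fun i _ => by split_ifs <;> rfl

end Instances

/-! ### Invariance of costs, feasibility and OPT under a correspondence -/

section Transfer

variable {K E K' E' : Type*} {P : OnlineProblem K E} {Q : OnlineProblem K' E'} {Φ : E → E'}
  {I : List K} {J : List K'}

namespace Corresponds

lemma length_eq (h : Corresponds P Q Φ I J) : I.length = J.length := h.2.2.2.2.length_eq

lemma cost_eq (h : Corresponds P Q Φ I J) (hs : P.start ∈ P.decisions) {x : Fin I.length → E}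
    (hx : ∀ t, x t ∈ P.decisions) :
    Q.cost J (fun t => Φ (x (Fin.cast h.length_eq.symm t))) = P.cost I x := by
  have hlen := h.length_eq
  have h0 := h.2.1
  have hmove := h.2.2.1
  have hhit := h.2.2.2.2
  have hstate : ∀ t, P.state x t ∈ P.decisions := by
    intro t
    unfold OnlineProblem.state
    split_ifs
    exacts [hx _, hs]
  have hstate' : ∀ t, Q.state (fun t => Φ (x (Fin.cast hlen.symm t))) t = Φ (P.state x t) := by
    intro t
    unfold OnlineProblem.state
    by_cases ht : 0 < t ∧ t ≤ I.length
    · rw [dif_pos ht, dif_pos (by rwa [← hlen])]; rfl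
    · rw [dif_neg ht, dif_neg (by rwa [← hlen]), h0]
  unfold OnlineProblem.cost
  congr 1
  · refine Fintype.sum_equiv (finCongr hlen.symm) _ _ fun t => ?_
    exact (List.forall₂_iff_get.1 hhit).2 t (t.2.trans_eq hlen.symm) t.2 _ (hx _)
  · refine Finset.sum_congr (by rw [hlen]) fun t _ => ?_
    rw [hstate', hstate', hmove _ (hstate _) _ (hstate _)]

lemma feasible_iff (h : Corresponds P Q Φ I J) {x : Fin I.length → E}
    (hx : ∀ t, x t ∈ P.decisions) :
    Q.Feasible J (fun t => Φ (x (Fin.cast h.length_eq.symm t))) ↔ P.Feasible I x := by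
  have hsum : ∑ t, Q.con (Φ (x (Fin.cast h.length_eq.symm t))) = ∑ t, P.con (x t) :=
    Fintype.sum_equiv (finCongr h.length_eq.symm) _ _ fun t => h.2.2.2.1 _ (hx _)
  unfold OnlineProblem.Feasible
  rw [hsum]
  exact and_congr_left fun _ => ⟨fun _ => hx, fun _ t => h.1.mapsTo (hx _)⟩

lemma opt_eq (h : Corresponds P Q Φ I J) (hs : P.start ∈ P.decisions) : Q.opt J = P.opt I := by
  unfold OnlineProblem.opt
  congr 1
  ext r
  constructor
  · rintro ⟨y, hy, rfl⟩
    choose x hx hxy using fun t => h.1.surjOn (hy.1 t)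
    have hy' : y = fun t => Φ ((fun s => x (Fin.cast h.length_eq s))
        (Fin.cast h.length_eq.symm t)) := funext fun t => (hxy t).symm
    refine ⟨fun s => x (Fin.cast h.length_eq s), ?_, ?_⟩
    · rwa [← h.feasible_iff fun t => hx _, ← hy']
    · rw [← h.cost_eq hs fun t => hx _, ← hy']
  · rintro ⟨x, hx, rfl⟩
    exact ⟨_, (h.feasible_iff hx.1).2 hx, (h.cost_eq hs hx.1).symm⟩

end Corresponds

end Transfer

/-! ## The equation for `α` -/

/-- As `s ≤ 0`, `s * exp (s - t) ≤ s * (1 + s - t)`, and this is at most `t` because `(s - t) * (1 +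
s) ≤ 0`. -/
lemma mul_exp_le_mul_exp {s t : ℝ} (hs : -1 ≤ s) (hst : s ≤ t) (ht : t ≤ 0) :
    s * Real.exp s ≤ t * Real.exp t := by
  have h1 : 1 + (s - t) ≤ Real.exp (s - t) := by linarith [Real.add_one_le_exp (s - t)]
  have h2 : Real.exp s = Real.exp (s - t) * Real.exp t := by rw [← Real.exp_add]; ring_nf
  have h3 : s * Real.exp (s - t) ≤ t := by nlinarith
  rw [h2, ← mul_assoc]
  exact mul_le_mul_of_nonneg_right h3 (Real.exp_pos t).le

lemma lambertW_spec {c x : ℝ} (hc0 : 0 ≤ c) (hc1 : c ≤ 1) (h1 : -c * Real.exp (-c) ≤ x)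
    (h2 : x ≤ 0) : -1 ≤ lambertW x ∧ lambertW x * Real.exp (lambertW x) = x := by
  have hx : ∃ v ∈ Set.Ici (-1 : ℝ), v * Real.exp v = x := by
    have hcont : ContinuousOn (fun v : ℝ => v * Real.exp v) (Set.Icc (-c) 0) := by fun_prop
    obtain ⟨v, hv, hvx⟩ := intermediate_value_Icc (by linarith) hcont
      (show x ∈ Set.Icc _ _ from ⟨h1, by simpa using h2⟩)
    exact ⟨v, by simp only [Set.mem_Ici]; linarith [hv.1], hvx⟩
  exact ⟨Function.invFunOn_mem hx, Function.invFunOn_eq hx⟩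

/-- The equation that characterises `α`. -/
lemma alphaRatio_spec {L U β : ℝ} (hL : 0 < L) (hβ : 0 ≤ β) (hβU : β < (U - L) / 2) :
    0 < alphaRatio L U β ∧ 0 < U - 2 * β - U / alphaRatio L U β ∧
      alphaRatio L U β *
        (Real.log (U - L - 2 * β) - Real.log (U - 2 * β - U / alphaRatio L U β)) = 1 := by
  have hU : 0 < U := by linarith
  obtain ⟨c, hc⟩ : ∃ c, c = 1 - 2 * β / U := ⟨_, rfl⟩
  have hcU : U * c = U - 2 * β := by rw [hc]; field_simp
  have hc1 : c ≤ 1 := by rw [hc]; linarith [show 0 ≤ 2 * β / U by positivity]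
  have hlc : L / U < c := by rw [div_lt_iff₀ hU]; linarith
  have hl0 : 0 < L / U := by positivity
  obtain ⟨x, hx⟩ : ∃ x, x = (2 * β / U + L / U - 1) * Real.exp (2 * β / U - 1) := ⟨_, rfl⟩
  have hx' : x = (L / U - c) * Real.exp (-c) := by rw [hx, hc]; ring_nf
  have he := Real.exp_pos (-c)
  have hx0 : x < 0 := by rw [hx']; nlinarith
  have hxc : -c * Real.exp (-c) < x := by rw [hx']; nlinarith
  obtain ⟨hs1, hs2⟩ := lambertW_spec (by linarith) hc1 hxc.le hx0.le
  have hα : alphaRatio L U β = (lambertW x + c)⁻¹ := by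
    rw [alphaRatio, ← hx, hc]; ring_nf
  set s := lambertW x
  have hs0 : s < 0 := by
    by_contra h
    push Not at h
    nlinarith [Real.exp_pos s]
  -- Monotonicity of `v * exp v` on `[-1, 0]` excludes `s ≤ -c`, as the value at `-c` is below `x`.
  have hsc : -c < s := by
    by_contra h
    push Not at h
    linarith [mul_exp_le_mul_exp hs1 h (by linarith)]
  have ha : 0 < s + c := by linarith
  have hu : U - 2 * β - U / alphaRatio L U β = U * -s := by
    rw [hα, div_inv_eq_mul, ← hcU]; ring
  -- The Lambert equation says that the two arguments of the logarithm differ by the factor `exp (s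
  -- + c)`, where `s + c = 1/α`.
  have hv : U - L - 2 * β = U * -s * Real.exp (s + c) := by
    have h1 : U - L - 2 * β = U * (c - L / U) := by
      rw [mul_sub, hcU, mul_div_cancel₀ _ hU.ne']; ring
    have h2 : (c - L / U) = -s * Real.exp (s + c) := by
      rw [Real.exp_add, neg_mul, ← mul_assoc, hs2, hx', mul_assoc, ← Real.exp_add]
      simp
    rw [h1, h2]; ring
  have hpos : 0 < U * -s := mul_pos hU (by linarith)
  refine ⟨hα ▸ inv_pos.2 ha, hu ▸ hpos, ?_⟩
  rw [hu, hv, Real.log_mul hpos.ne' (Real.exp_pos _).ne', Real.log_exp, hα]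
  field_simp
  ring

/-! ## The potential argument -/

/-- A player who has bought the amount `V` and saved the amount `F` on the price `U` cannot keep
the savings at every level as large as a competitive ratio below `α` demands. -/
lemma no_savings {U α σ Δ e : ℝ} {n i₀ : ℕ} (Inv : ℕ → ℝ → ℝ → Prop) (hα : 0 < α)
    (hΔ : 0 < Δ) (hi₀ : 0 < i₀) (hin : i₀ ≤ n) (hu : 0 < i₀ * Δ + e) (hU : n * Δ + e ≤ U)
    (hcontra : 1 < (U - α * (U - i₀ * Δ) + σ) / (i₀ * Δ + e) +
      α * (Real.log ((n + 1) * Δ + e) - Real.log ((i₀ + 1) * Δ + e)))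
    (h0 : Inv 0 0 0)
    (hstep : ∀ i < n, ∀ V F, Inv i V F → ∃ v, 0 ≤ v ∧
      Inv (i + 1) (V + v) (F + v * ((i + 1) * Δ + e)) ∧
      U * max 1 (V + v) - α * (U - (i + 1) * Δ) + σ ≤ F + v * ((i + 1) * Δ + e)) : False := by
  -- The last conjunct bounds the potential `V - (F - R_i)/u_i` from below, where `R_i = U - α(U -
  -- iΔ) + σ` and `u_i = iΔ + e`. It is followed only from `i₀` on, where `u_i > 0`.
  have claim : ∀ i ≤ n, ∃ V F, Inv i V F ∧ 0 ≤ V ∧ F ≤ (i * Δ + e) * V ∧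
      (0 < i → U * max 1 V - α * (U - i * Δ) + σ ≤ F) ∧
      (i₀ ≤ i → (U - α * (U - i₀ * Δ) + σ) / (i₀ * Δ + e) +
        α * (Real.log ((i + 1) * Δ + e) - Real.log ((i₀ + 1) * Δ + e)) ≤
        V - (F - (U - α * (U - i * Δ) + σ)) / (i * Δ + e)) := by
    intro i
    induction i with
    | zero =>
      intro _
      exact ⟨0, 0, h0, le_rfl, by simp, fun h => absurd h (lt_irrefl 0), fun h => by omega⟩
    | succ i ih =>
      intro hi
      obtain ⟨V, F, hInv, hV, hF, hD, hΨ⟩ := ih (by omega)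
      obtain ⟨v, hv, hInv', hD'⟩ := hstep i (by omega) V F hInv
      have hF' : F + v * ((i + 1) * Δ + e) ≤ ((i + 1 : ℕ) * Δ + e) * (V + v) := by
        push_cast
        nlinarith [mul_nonneg hΔ.le hV]
      refine ⟨V + v, _, hInv', by linarith, hF', fun _ => by push_cast; exact hD', fun hi0 => ?_⟩
      rcases Nat.lt_or_ge i i₀ with hlt | hge
      · have heq : i₀ = i + 1 := by omega
        subst heq
        -- At `i₀` the bound is `R/u`, since all savings so far were made at rates of at most `u`.
        rw [sub_self, mul_zero, add_zero, sub_div, le_sub_iff_add_le]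
        have h1 : (F + v * ((i + 1) * Δ + e)) / (((i + 1 : ℕ) : ℝ) * Δ + e) ≤ V + v := by
          rw [div_le_iff₀ hu]
          linarith
        linarith
      · have hpos : 0 < i * Δ + e := by
          have : (i₀ : ℝ) * Δ ≤ i * Δ :=
            mul_le_mul_of_nonneg_right (by exact_mod_cast hge) hΔ.le
          linarith
        have hpos1 : 0 < (i + 1) * Δ + e := by linarith
        have hpos2 : 0 < (i + 1 + 1) * Δ + e := by linarith
        have hD0 : 0 ≤ F - (U - α * (U - i * Δ) + σ) := by
          have h1 := hD (by omega)
          have hU0 : 0 < U := by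
            have : (i : ℝ) * Δ ≤ n * Δ :=
              mul_le_mul_of_nonneg_right (by exact_mod_cast (by omega : i ≤ n)) hΔ.le
            linarith
          nlinarith [le_max_left 1 V]
        -- The potential gains at least `αΔ/u_{i+1}`; shifting the logarithms by one index makes
        -- this gain dominate their increment.
        have hlog : Real.log ((i + 1 + 1) * Δ + e) - Real.log ((i + 1) * Δ + e) ≤
            Δ / ((i + 1) * Δ + e) := by
          rw [← Real.log_div hpos2.ne' hpos1.ne']
          refine (Real.log_le_sub_one_of_pos (by positivity)).trans_eq ?_
          field_simp
          ring
        have h2 : (F - (U - α * (U - i * Δ) + σ)) / ((i + 1) * Δ + e) ≤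
            (F - (U - α * (U - i * Δ) + σ)) / (i * Δ + e) :=
          div_le_div_of_nonneg_left hD0 hpos (by linarith)
        -- The purchase `v` at rate `u_{i+1}` cancels in the potential, while `R` increases by `αΔ`.
        have h3 : (F + v * ((i + 1) * Δ + e) - (U - α * (U - (i + 1) * Δ) + σ)) /
            ((i + 1) * Δ + e) = (F - (U - α * (U - i * Δ) + σ)) / ((i + 1) * Δ + e) + v -
              α * (Δ / ((i + 1) * Δ + e)) := by
          field_simp
          ring
        push_cast
        rw [h3]
        have h4 := hΨ hge
        nlinarith [mul_le_mul_of_nonneg_left hlog hα.le]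
  obtain ⟨V, F, -, -, -, hD, hΨ⟩ := claim n le_rfl
  have hD := hD (by omega)
  have hΨ := hΨ hin
  have hpos : 0 < n * Δ + e := by
    have : (i₀ : ℝ) * Δ ≤ n * Δ := mul_le_mul_of_nonneg_right (by exact_mod_cast hin) hΔ.le
    linarith
  -- Since `u_n ≤ U`, the savings required at the last level keep the potential at most `1`.
  have h1 : V - 1 ≤ (F - (U - α * (U - n * Δ) + σ)) / (n * Δ + e) := by
    rw [le_div_iff₀ hpos]
    have h2 : U * max 1 V - U ≤ F - (U - α * (U - n * Δ) + σ) := by linarith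
    refine le_trans ?_ h2
    rcases le_total V 1 with h | h
    · rw [max_eq_left h]
      nlinarith
    · rw [max_eq_right h]
      nlinarith
  linarith

/-- If nonnegative summands add up to a large total, then one of them dominates the sum of its
predecessors, while the partial sum is not too small. -/
lemma exists_dominating {x s : ℕ → ℝ} {τ M : ℝ} (hτ : 0 ≤ τ) (hM : 0 ≤ M)
    (hs0 : s 0 = 0) (hs : ∀ j, s (j + 1) = s j + x j) {m : ℕ}
    (h : τ * (M + 1) ^ m < s m) : ∃ j < m, τ < s (j + 1) ∧ M * s j ≤ x j := by
  by_contra hcon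
  push Not at hcon
  -- Without domination, a partial sum above `τ` is less than `M + 1` times its predecessor.
  have : ∀ j ≤ m, s j ≤ τ * (M + 1) ^ j := by
    intro j
    induction j with
    | zero => intro _; simpa [hs0] using hτ
    | succ j ih =>
      intro hj
      rcases le_or_gt (s (j + 1)) τ with h1 | h1
      · exact h1.trans (le_mul_of_one_le_right hτ (one_le_pow₀ (by linarith)))
      · have h2 := hcon j hj h1
        have h3 := mul_le_mul_of_nonneg_right (ih (by omega)) (show 0 ≤ M + 1 by linarith)
        rw [pow_succ, ← mul_assoc]
        linarith [hs j]
  exact absurd (this m le_rfl) (not_le.2 h)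

/-! ## Sums along a sequence of prices -/

/-- The sum over the prices of `q`, presented after those of `p`, of a quantity that depends on the
past prices and the current one. -/
def pathSum (f : List ℝ → ℝ → ℝ) : List ℝ → List ℝ → ℝ
  | _, [] => 0
  | p, c :: q => f p c + pathSum f (p ++ [c]) q

lemma pathSum_append (f : List ℝ → ℝ → ℝ) (p q r : List ℝ) :
    pathSum f p (q ++ r) = pathSum f p q + pathSum f (p ++ q) r := by
  induction q generalizing p with
  | nil => simp [pathSum]
  | cons c q ih => simp [pathSum, ih, add_assoc]

lemma pathSum_singleton (f : List ℝ → ℝ → ℝ) (p : List ℝ) (c : ℝ) :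
    pathSum f p [c] = f p c := by
  simp [pathSum]

lemma pathSum_mono {f g : List ℝ → ℝ → ℝ} {q : List ℝ} (h : ∀ p, ∀ c ∈ q, f p c ≤ g p c)
    (p : List ℝ) : pathSum f p q ≤ pathSum g p q := by
  induction q generalizing p with
  | nil => exact le_rfl
  | cons c q ih =>
    exact add_le_add (h _ _ List.mem_cons_self)
      (ih (fun p c hc => h p c (List.mem_cons_of_mem _ hc)) _)

lemma pathSum_mul (x : ℝ) (f : List ℝ → ℝ → ℝ) (p q : List ℝ) :
    pathSum (fun p c => x * f p c) p q = x * pathSum f p q := by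
  induction q generalizing p with
  | nil => simp [pathSum]
  | cons c q ih => simp [pathSum, ih, mul_add]

lemma pathSum_nonneg {f : List ℝ → ℝ → ℝ} (h : ∀ p c, 0 ≤ f p c) (p q : List ℝ) :
    0 ≤ pathSum f p q := by
  have := pathSum_mono (q := q) (fun p c _ => (zero_mul (f p c)).trans_le (h p c)) p
  rwa [pathSum_mul, zero_mul] at this

lemma pathSum_nil_eq_sum (f : List ℝ → ℝ → ℝ) (q : List ℝ) :
    pathSum f [] q = ∑ t : Fin q.length, f (q.take t) (q.get t) := by
  suffices h : ∀ p, pathSum f p q = ∑ t : Fin q.length, f (p ++ q.take t) (q.get t) by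
    simpa using h []
  induction q with
  | nil => intro p; simp [pathSum]
  | cons c q ih =>
    intro p
    simp only [pathSum, List.length_cons, Fin.sum_univ_succ, ih]
    simp

/-- The total of `a` over the decisions made on the prices of `q`, presented after those of `p`. -/
def bought (a : List ℝ → ℝ) (p q : List ℝ) : ℝ := pathSum (fun p c => a (p ++ [c])) p q

/-- The cost, on the prices of `q` presented after those of `p`, of decisions that buy the amount
`b` at the current price and the amount `a - b` at the price `U`, if changes of `b` cost `β` per
unit. -/
def priceCost (U β : ℝ) (a b : List ℝ → ℝ) (p q : List ℝ) : ℝ :=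
  pathSum (fun p c => U * a (p ++ [c]) - (U - c) * b (p ++ [c]) + β * |b p - b (p ++ [c])|) p q

section

variable {U β : ℝ} {a b : List ℝ → ℝ}

lemma bought_append (a : List ℝ → ℝ) (p q r : List ℝ) :
    bought a p (q ++ r) = bought a p q + bought a (p ++ q) r := pathSum_append _ _ _ _

lemma priceCost_append (U β : ℝ) (a b : List ℝ → ℝ) (p q r : List ℝ) :
    priceCost U β a b p (q ++ r) = priceCost U β a b p q + priceCost U β a b (p ++ q) r :=
  pathSum_append _ _ _ _

lemma bought_nonneg (ha : ∀ q, 0 ≤ a q) (p q : List ℝ) : 0 ≤ bought a p q :=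
  pathSum_nonneg (fun _ _ => ha _) p q

lemma bought_mono (h : ∀ q, b q ≤ a q) (p q : List ℝ) : bought b p q ≤ bought a p q :=
  pathSum_mono (fun _ _ _ => h _) p

/-- By the triangle inequality the switching along a batch costs at least its net change. -/
lemma le_priceCost_const (hβ : 0 ≤ β) {y : ℝ} {q : List ℝ} (hq : ∀ c ∈ q, c = y) (p : List ℝ) :
    U * bought a p q - (U - y) * bought b p q + β * |b p - b (p ++ q)| ≤
      priceCost U β a b p q := by
  induction q generalizing p with
  | nil => simp [bought, priceCost, pathSum]
  | cons c q ih =>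
    have h1 := ih (fun c hc => hq c (List.mem_cons_of_mem _ hc)) (p ++ [c])
    have h2 : c = y := hq c List.mem_cons_self
    simp only [bought, priceCost, pathSum] at h1 ⊢
    rw [List.append_assoc, List.singleton_append] at h1
    have h3 := mul_le_mul_of_nonneg_left
      (abs_sub_le (b p) (b (p ++ [c])) (b (p ++ c :: q))) hβ
    subst h2
    linarith

/-- The discount `U - c` applies to at most the whole purchase, so every unit costs at least `c ≥
L`. -/
lemma le_priceCost_of_le (hβ : 0 ≤ β) (hb : ∀ q, 0 ≤ b q) (hab : ∀ q, b q ≤ a q) {L : ℝ}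
    {q : List ℝ} (hq : ∀ c ∈ q, c ∈ Set.Icc L U) (p : List ℝ) :
    L * bought a p q ≤ priceCost U β a b p q := by
  rw [bought, ← pathSum_mul]
  refine pathSum_mono (fun p c hc => ?_) p
  have h1 := mul_nonneg hβ (abs_nonneg (b p - b (p ++ [c])))
  have h2 := mul_le_mul_of_nonneg_left (hab (p ++ [c])) (sub_nonneg.2 (hq c hc).2)
  have h3 := mul_le_mul_of_nonneg_right (hq c hc).1 ((hb (p ++ [c])).trans (hab _))
  linarith

lemma le_bought_replicate {κ c : ℝ} {r : ℕ} (p : List ℝ)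
    (h : ∀ s < r, κ ≤ a (p ++ List.replicate (s + 1) c)) :
    r * κ ≤ bought a p (List.replicate r c) := by
  induction r with
  | zero => simp [bought, pathSum]
  | succ r ih =>
    have h1 := ih fun s hs => h s (by omega)
    have h2 := h r (by omega)
    rw [List.replicate_succ', bought_append]
    rw [List.replicate_succ', ← List.append_assoc] at h2
    simp only [bought, pathSum_singleton] at h1 ⊢
    push_cast
    linarith

end

/-! ## The adversary -/

/-- Sequences of Up and Down prices in which the Down levels are below `l` and do not decrease, and
each occurs at most `m` times. -/
def IsPricePrefix (U δ : ℝ) (m l : ℕ) (p : List ℝ) : Prop :=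
  ∃ levels : List ℕ, (∀ i ∈ levels, i ≤ l) ∧ (∀ i ∈ levels, i ≠ 0 → i < l) ∧
    levels.Pairwise (fun i j => i ≠ 0 → j ≠ 0 → i ≤ j) ∧
    (∀ i, i ≠ 0 → levels.count i ≤ m) ∧ p = levels.map (fun i : ℕ => U - i * δ)

section

variable {U δ : ℝ} {m l : ℕ} {p : List ℝ}

lemma isPricePrefix_nil : IsPricePrefix U δ m 0 [] :=
  ⟨[], by simp, by simp, by simp, by simp, by simp⟩

lemma IsPricePrefix.mono (h : IsPricePrefix U δ m l p) {l' : ℕ} (hl : l ≤ l') :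
    IsPricePrefix U δ m l' p := by
  obtain ⟨levels, h1, h2, h3, h4, h5⟩ := h
  exact ⟨levels, fun i hi => (h1 i hi).trans hl, fun i hi h0 => (h2 i hi h0).trans_le hl, h3, h4,
    h5⟩

/-- A nonzero level `l` is still unused in `p`, so the batch alone decides its count; Up prices are
free of all restrictions. -/
lemma IsPricePrefix.append (h : IsPricePrefix U δ m l p) {j : ℕ} (hj : j ≤ m) (r : ℕ) :
    IsPricePrefix U δ m (l + 1)
      (p ++ List.replicate j (U - l * δ) ++ List.replicate r U) := by
  obtain ⟨levels, h1, h2, h3, h4, rfl⟩ := h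
  refine ⟨levels ++ List.replicate j l ++ List.replicate r 0, ?_, ?_, ?_, ?_, ?_⟩
  · intro i hi
    rw [List.mem_append, List.mem_append] at hi
    rcases hi with (hi | hi) | hi
    · exact (h1 i hi).trans (Nat.le_succ l)
    · rw [List.eq_of_mem_replicate hi]; exact Nat.le_succ l
    · rw [List.eq_of_mem_replicate hi]; exact Nat.zero_le _
  · intro i hi h0
    rw [List.mem_append, List.mem_append] at hi
    rcases hi with (hi | hi) | hi
    · exact (h2 i hi h0).trans (Nat.lt_succ_self l)
    · rw [List.eq_of_mem_replicate hi]; exact Nat.lt_succ_self l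
    · exact absurd (List.eq_of_mem_replicate hi) h0
  · rw [List.pairwise_append, List.pairwise_append]
    refine ⟨⟨h3, List.pairwise_replicate.2 (Or.inr fun _ _ => le_rfl), ?_⟩,
      List.pairwise_replicate.2 (Or.inr fun _ _ => le_rfl), ?_⟩
    · intro i hi j hj _ _
      rw [List.eq_of_mem_replicate hj]
      exact h1 i hi
    · intro i _ j hj _ h0
      exact absurd (List.eq_of_mem_replicate hj) h0
  · intro i h0
    rw [List.count_append, List.count_append, List.count_eq_zero_of_not_mem (l := .replicate r 0)
      fun h => h0 (List.eq_of_mem_replicate h), add_zero]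
    by_cases hil : i = l
    · subst hil
      rw [List.count_eq_zero_of_not_mem (l := levels) fun hi => (h2 i hi h0).false, zero_add,
        List.count_replicate_self]
      exact hj
    · rw [List.count_eq_zero_of_not_mem (l := .replicate j l)
        fun h => hil (List.eq_of_mem_replicate h), add_zero]
      exact h4 i h0
  · simp

lemma IsPricePrefix.mem_lowerBoundPrices {L : ℝ} {N w m' : ℕ}
    (h : IsPricePrefix U ((U - L) / w) m l p) (hLU : L ≤ U) (hw : 0 < w) (hNw : N ≤ w)
    (hm : 0 < m) (hNm : N ≤ m) (hl : l ≤ w) (hmm : m ≤ m') :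
    p ++ List.replicate m (U - l * ((U - L) / w)) ++ List.replicate m' U ∈
      lowerBoundPrices L U N := by
  obtain ⟨levels, h1, -, h3, h4, rfl⟩ := h
  have hδ : 0 ≤ (U - L) / w := div_nonneg (by linarith) (Nat.cast_nonneg _)
  refine ⟨w, m, l, m', _, _, 0, levels, hw, hNw, hm, hNm, hmm, hl, rfl, rfl, le_rfl, hδ, ?_, h1,
    h3, h4, by rw [add_zero]⟩
  rw [add_zero]
  have : 0 ≤ l * ((U - L) / w) := by positivity
  linarith

lemma IsPricePrefix.mem_Icc {L : ℝ} (h : IsPricePrefix U δ m l p) {w : ℕ} (hl : l ≤ w)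
    (hδ : 0 ≤ δ) (hw : w * δ ≤ U - L) : ∀ c ∈ p, c ∈ Set.Icc L U := by
  obtain ⟨levels, h1, -, -, -, rfl⟩ := h
  intro c hc
  obtain ⟨i, hi, rfl⟩ := List.mem_map.1 hc
  have h2 : (i : ℝ) * δ ≤ w * δ :=
    mul_le_mul_of_nonneg_right (by exact_mod_cast (h1 i hi).trans hl) hδ
  have h3 : 0 ≤ i * δ := by positivity
  constructor <;> linarith

end

/-- Decisions, depending on the prices presented so far, whose cost is at most
`ρ (y + 2β / m)` on all lower-bound instances of horizon `T` with `ε = 0`. -/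
structure IsCheap (L U β ρ δ : ℝ) (w m T : ℕ) (a b : List ℝ → ℝ) : Prop where
  L_pos : 0 < L
  L_le : L ≤ U
  β_nonneg : 0 ≤ β
  ρ_nonneg : 0 ≤ ρ
  δ_nonneg : 0 ≤ δ
  mul_δ : w * δ = U - L
  m_pos : 0 < m
  nil : b [] = 0
  nonneg : ∀ q, 0 ≤ b q
  le : ∀ q, b q ≤ a q
  complete : ∀ l ≤ w, ∀ m' ≥ m, ∀ p, IsPricePrefix U δ m l p → p.length + m + m' = T →
    1 ≤ bought a [] (p ++ List.replicate m (U - l * δ) ++ List.replicate m' U)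
  cost_le : ∀ l ≤ w, ∀ m' ≥ m, ∀ p, IsPricePrefix U δ m l p → p.length + m + m' = T →
    priceCost U β a b [] (p ++ List.replicate m (U - l * δ) ++ List.replicate m' U) ≤
      ρ * (U - l * δ + 2 * β / m)

namespace IsCheap

variable {L U β ρ δ : ℝ} {w m T : ℕ} {a b : List ℝ → ℝ}

lemma a_nonneg (h : IsCheap L U β ρ δ w m T a b) (q : List ℝ) : 0 ≤ a q :=
  (h.nonneg q).trans (h.le q)

lemma level_mem_Icc (h : IsCheap L U β ρ δ w m T a b) {l : ℕ} (hl : l ≤ w) :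
    U - l * δ ∈ Set.Icc L U := by
  have h1 : (l : ℝ) * δ ≤ w * δ := mul_le_mul_of_nonneg_right (by exact_mod_cast hl) h.δ_nonneg
  have h2 : 0 ≤ l * δ := mul_nonneg (Nat.cast_nonneg _) h.δ_nonneg
  have h3 := h.mul_δ
  constructor <;> linarith

/-- The prefix can be completed to an instance, whose cost is at most `ρ (U + 2β)`, while each unit
costs at least `L`. This a priori bound limits how long the adversary has to wait. -/
lemma bought_le (h : IsCheap L U β ρ δ w m T a b) {p : List ℝ} (hp : IsPricePrefix U δ m w p)
    (hT : p.length + 2 * m ≤ T) : L * bought a [] p ≤ ρ * (U + 2 * β) := by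
  have hI := h.cost_le w le_rfl (T - p.length - m) (by omega) p hp (by omega)
  have hprice : ∀ c ∈ p ++ List.replicate m (U - w * δ) ++ List.replicate (T - p.length - m) U,
      c ∈ Set.Icc L U := by
    intro c hc
    rw [List.mem_append, List.mem_append] at hc
    rcases hc with (hc | hc) | hc
    · exact hp.mem_Icc le_rfl h.δ_nonneg h.mul_δ.le c hc
    · rw [List.eq_of_mem_replicate hc]; exact h.level_mem_Icc le_rfl
    · rw [List.eq_of_mem_replicate hc]; exact ⟨h.L_le, le_rfl⟩
  have h1 := le_priceCost_of_le h.β_nonneg h.nonneg h.le hprice []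
  rw [List.append_assoc, bought_append] at h1
  rw [List.append_assoc] at hI
  have h2 := mul_nonneg h.L_pos.le (bought_nonneg h.a_nonneg ([] ++ p)
    (List.replicate m (U - w * δ) ++ List.replicate (T - p.length - m) U))
  have h3 : ρ * (U - w * δ + 2 * β / m) ≤ ρ * (U + 2 * β) := by
    refine mul_le_mul_of_nonneg_left ?_ h.ρ_nonneg
    have h4 : 2 * β / m ≤ 2 * β :=
      div_le_self (by linarith [h.β_nonneg]) (by exact_mod_cast h.m_pos)
    linarith [(h.level_mem_Icc le_rfl).2]
  linarith

/-- If the price stays high, then the player gives up the position. -/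
lemma exists_return (h : IsCheap L U β ρ δ w m T a b) {l j r : ℕ} {p : List ℝ} {κ : ℝ}
    (hp : IsPricePrefix U δ m l p) (hl : l < w) (hj : j ≤ m) (hr : ρ * (U + 2 * β) < L * (r * κ))
    (hT : p.length + m + r + 2 * m ≤ T) :
    ∃ r' ≤ r, b (p ++ List.replicate j (U - l * δ) ++ List.replicate r' U) ≤ κ := by
  by_contra hcon
  push Not at hcon
  have h1 := h.bought_le ((hp.append hj r).mono hl) (by simp; omega)
  -- Holding more than `κ` through `r` Up prices would mean buying at least `r * κ`, beyond the a
  -- priori bound.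
  have h2 := le_bought_replicate (a := a) (κ := κ) (c := U) (r := r)
    (p ++ List.replicate j (U - l * δ)) fun s hs => (hcon (s + 1) hs).le.trans (h.le _)
  rw [bought_append, List.nil_append] at h1
  have h3 := bought_nonneg h.a_nonneg [] (p ++ List.replicate j (U - l * δ))
  have h4 := mul_le_mul_of_nonneg_left h2 h.L_pos.le
  have h5 := mul_nonneg h.L_pos.le h3
  linarith

/-- `p'` prolongs a price sequence `p` in such a way that the player buys the amount `v` and saves
at most `u` per unit, compared to the price `U`. -/
def Prolongs (U β : ℝ) (a b : List ℝ → ℝ) (p p' : List ℝ) (v u : ℝ) : Prop :=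
  bought a [] p + v ≤ bought a [] p' ∧
    priceCost U β a b [] p - U * bought a [] p - v * u ≤
      priceCost U β a b [] p' - U * bought a [] p'

/-- If the player would buy a substantial amount during `m` consecutive Down prices, then the
adversary can make the player buy while paying for switching. -/
lemma exists_interrupt (h : IsCheap L U β ρ δ w m T a b) {l r : ℕ} {p : List ℝ} {τ M : ℝ}
    (hp : IsPricePrefix U δ m l p) (hl : l < w) (hτ : 0 < τ) (hM : 0 < M)
    (hr : ρ * (U + 2 * β) < L * (r * (τ / M)))
    (hT : p.length + m + r + 2 * m ≤ T) (hbp : b p ≤ τ / M)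
    (hbad : τ * (M + 1) ^ m < bought b p (List.replicate m (U - l * δ))) :
    ∃ p' v, IsPricePrefix U δ m (l + 1) p' ∧ p'.length ≤ p.length + m + r ∧ b p' ≤ τ / M ∧
      τ ≤ v ∧ Prolongs U β a b p p' v (l * δ - 2 * β + 4 * β / M) := by
  obtain ⟨y, hy⟩ : ∃ y, y = U - l * δ := ⟨_, rfl⟩
  rw [← hy] at hbad
  have hrep : ∀ j, List.replicate (j + 1) y = List.replicate j y ++ [y] := fun j =>
    List.replicate_succ'
  have hs : ∀ j, bought b p (List.replicate (j + 1) y) =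
      bought b p (List.replicate j y) + b (p ++ List.replicate (j + 1) y) := by
    intro j
    rw [hrep, bought_append, ← List.append_assoc]
    simp only [bought, pathSum_singleton]
  -- The batch is cut off right after the dominating decision, at length `j + 1 ≤ m`.
  obtain ⟨j, hjm, hj1, hj2⟩ := exists_dominating (s := fun j => bought b p (List.replicate j y))
    (x := fun j => b (p ++ List.replicate (j + 1) y)) hτ.le hM.le rfl hs hbad
  obtain ⟨r', hr', hret⟩ := h.exists_return hp hl (j := j + 1) hjm hr hT
  have hpre := hp.append (j := j + 1) hjm r'
  rw [← hy] at hret hpre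
  refine ⟨_, bought b p (List.replicate (j + 1) y), hpre, ?_, hret, hj1.le, ?_⟩
  · simp; omega
  · have h1 := le_priceCost_const (U := U) (a := a) (b := b) h.β_nonneg
      (q := List.replicate (j + 1) y) (fun c hc => List.eq_of_mem_replicate hc) p
    have h2 := le_priceCost_const (U := U) (a := a) (b := b) h.β_nonneg
      (q := List.replicate r' U) (fun c hc => List.eq_of_mem_replicate hc)
      (p ++ List.replicate (j + 1) y)
    have h3 := bought_mono h.le p (List.replicate (j + 1) y)
    have h4 := bought_nonneg h.a_nonneg (p ++ List.replicate (j + 1) y) (List.replicate r' U)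
    unfold Prolongs
    rw [bought_append, bought_append, priceCost_append, priceCost_append, List.nil_append,
      List.nil_append]
    refine ⟨by linarith, ?_⟩
    rw [sub_self, zero_mul, sub_zero] at h2
    have h5 := mul_le_mul_of_nonneg_left (neg_abs_le (b p - b (p ++ List.replicate (j + 1) y)))
      h.β_nonneg
    have h6 := mul_le_mul_of_nonneg_left (le_abs_self (b (p ++ List.replicate (j + 1) y) -
      b (p ++ List.replicate (j + 1) y ++ List.replicate r' U))) h.β_nonneg
    have hsj := hs j
    set v := bought b p (List.replicate (j + 1) y)
    set x := b (p ++ List.replicate (j + 1) y)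
    have hv : τ / M ≤ v / M := div_le_div_of_nonneg_right hj1.le hM.le
    have h7 : bought b p (List.replicate j y) ≤ v / M := by
      rw [le_div_iff₀ hM]
      have := bought_nonneg h.nonneg p (List.replicate j y)
      linarith [mul_comm M (bought b p (List.replicate j y))]
    have h8 : v * (l * δ - 2 * β + 4 * β / M) =
        v * (U - y) - 2 * β * v + 4 * (β * (v / M)) := by
      rw [hy]; ring
    -- The position rises from at most `v/M` to at least `v - v/M` and falls back to at most `v/M`,
    -- which costs at least `2βv - 4βv/M`.
    have h9 : β * (v - v / M) ≤ β * x := mul_le_mul_of_nonneg_left (by linarith) h.β_nonneg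
    have h10 : β * b p ≤ β * (v / M) := mul_le_mul_of_nonneg_left (hbp.trans hv) h.β_nonneg
    have h11 : β * b (p ++ List.replicate (j + 1) y ++ List.replicate r' U) ≤ β * (v / M) :=
      mul_le_mul_of_nonneg_left (hret.trans hv) h.β_nonneg
    rw [h8]
    linarith

/-- Among sufficiently many consecutive levels there is one at which the player buys little during
`m` consecutive Down prices. -/
lemma exists_quiet_level (h : IsCheap L U β ρ δ w m T a b) {l r B : ℕ} {p : List ℝ} {τ M u : ℝ}
    (hp : IsPricePrefix U δ m l p) (hl : l + B ≤ w) (hτ : 0 < τ) (hM : 0 < M)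
    (hr : ρ * (U + 2 * β) < L * (r * (τ / M)))
    (hT : p.length + B * (m + r) + 2 * m ≤ T) (hbp : b p ≤ τ / M)
    (hu : (l + B : ℕ) * δ - 2 * β + 4 * β / M ≤ u) (hB : ρ * (U + 2 * β) < L * (B * τ)) :
    ∃ l' p' v, l ≤ l' ∧ l' < l + B ∧ IsPricePrefix U δ m l' p' ∧
      p'.length ≤ p.length + B * (m + r) ∧ b p' ≤ τ / M ∧ 0 ≤ v ∧ Prolongs U β a b p p' v u ∧
      bought b p' (List.replicate m (U - l' * δ)) ≤ τ * (M + 1) ^ m := by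
  by_contra hcon
  push Not at hcon
  -- Each interrupted level adds a purchase of at least `τ`; `B` of them in a row would break the a
  -- priori bound.
  have claim : ∀ q ≤ B, ∃ p' v, IsPricePrefix U δ m (l + q) p' ∧
      p'.length ≤ p.length + q * (m + r) ∧ b p' ≤ τ / M ∧ q * τ ≤ v ∧
      Prolongs U β a b p p' v u := by
    intro q
    induction q with
    | zero => exact fun _ => ⟨p, 0, hp, by simp, hbp, by simp, by simp [Prolongs]⟩
    | succ q ih =>
      intro hq
      obtain ⟨p₁, v₁, hp₁, hlen₁, hb₁, hv₁, hpr₁⟩ := ih (by omega)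
      have hmul : (q + 1) * (m + r) ≤ B * (m + r) := Nat.mul_le_mul_right _ hq
      have hmul' : (q + 1) * (m + r) = q * (m + r) + m + r := by ring
      have hv₁0 : 0 ≤ v₁ := le_trans (by positivity) hv₁
      have hbad := hcon (l + q) p₁ v₁ (by omega) (by omega) hp₁ (by omega) hb₁ hv₁0 hpr₁
      obtain ⟨p₂, v₂, hp₂, hlen₂, hb₂, hv₂, hpr₂⟩ := h.exists_interrupt hp₁ (by omega) hτ hM hr
        (by omega) hb₁ hbad
      refine ⟨p₂, v₁ + v₂, hp₂, by omega, hb₂, by push_cast; linarith, ?_, ?_⟩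
      · linarith [hpr₁.1, hpr₂.1]
      · have h1 : ((l + q : ℕ) : ℝ) * δ ≤ (l + B : ℕ) * δ :=
          mul_le_mul_of_nonneg_right (by exact_mod_cast (by omega : l + q ≤ l + B)) h.δ_nonneg
        have h2 : v₂ * ((l + q : ℕ) * δ - 2 * β + 4 * β / M) ≤ v₂ * u :=
          mul_le_mul_of_nonneg_left (by linarith) (hτ.le.trans hv₂)
        linarith [hpr₁.2, hpr₂.2]
  obtain ⟨p', v, hp', hlen, -, hv, hpr⟩ := claim B le_rfl
  have h1 := h.bought_le (hp'.mono hl) (by omega)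
  have h2 := hpr.1
  have h3 := bought_nonneg h.a_nonneg [] p
  have h4 : L * (B * τ) ≤ L * bought a [] p' :=
    mul_le_mul_of_nonneg_left (by linarith) h.L_pos.le
  linarith

/-- Stopping at a level at which the player buys little forces large savings beforehand. -/
lemma savings_ge (h : IsCheap L U β ρ δ w m T a b) {l : ℕ} {p : List ℝ} {η V F : ℝ}
    (hp : IsPricePrefix U δ m l p) (hl : l ≤ w) (hT : p.length + 2 * m ≤ T)
    (hV : V ≤ bought a [] p) (hF : -F ≤ priceCost U β a b [] p - U * bought a [] p)
    (hη : bought b p (List.replicate m (U - l * δ)) ≤ η) :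
    U * max 1 V - U * η - ρ * (U - l * δ + 2 * β / m) ≤ F := by
  have h0 := h.complete l hl (T - p.length - m) (by omega) p hp (by omega)
  have hI := h.cost_le l hl (T - p.length - m) (by omega) p hp (by omega)
  have h1 := le_priceCost_const (U := U) (a := a) (b := b) h.β_nonneg
    (q := List.replicate m (U - l * δ)) (fun c hc => List.eq_of_mem_replicate hc) p
  have h2 := le_priceCost_const (U := U) (a := a) (b := b) h.β_nonneg
    (q := List.replicate (T - p.length - m) U) (fun c hc => List.eq_of_mem_replicate hc)
    (p ++ List.replicate m (U - l * δ))
  rw [bought_append, bought_append, List.nil_append, List.nil_append] at h0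
  rw [priceCost_append, priceCost_append, List.nil_append, List.nil_append] at hI
  rw [sub_self, zero_mul, sub_zero] at h2
  have h3 := mul_nonneg h.β_nonneg (abs_nonneg (b p - b (p ++ List.replicate m (U - l * δ))))
  have h4 := mul_nonneg h.β_nonneg (abs_nonneg (b (p ++ List.replicate m (U - l * δ)) -
    b (p ++ List.replicate m (U - l * δ) ++ List.replicate (T - p.length - m) U)))
  have h5 := bought_nonneg h.nonneg p (List.replicate m (U - l * δ))
  have h6 := bought_nonneg h.a_nonneg p (List.replicate m (U - l * δ))
  have h7 := bought_nonneg h.a_nonneg (p ++ List.replicate m (U - l * δ))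
    (List.replicate (T - p.length - m) U)
  have hU : 0 < U := h.L_pos.trans_le h.L_le
  have h8 : (U - (U - l * δ)) * bought b p (List.replicate m (U - l * δ)) ≤ U * η := by
    refine mul_le_mul ?_ hη h5 hU.le
    linarith [(h.level_mem_Icc hl).1, h.L_pos]
  -- The final total is at least `1` by the constraint and at least `V` because purchases are never
  -- undone.
  have h9 : U * max 1 V ≤ U * (bought a [] p + bought a p (List.replicate m (U - l * δ)) +
      bought a (p ++ List.replicate m (U - l * δ)) (List.replicate (T - p.length - m) U)) :=
    mul_le_mul_of_nonneg_left (max_le h0 (by linarith)) hU.le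
  linarith

/-- A player cannot be cheap on the instances with sufficiently fine levels and sufficiently long
batches if `ρ` is less than the competitive ratio `α`. -/
lemma false_of_parameters {α σ θ τ M Δ : ℝ} {n B r : ℕ}
    (h : IsCheap L U β ρ δ (n * B) m T a b) (hα : 0 < α) (hn : 0 < n) (hτ : 0 < τ) (hM : 0 < M)
    (hΔ : Δ = B * δ) (hΔ0 : 0 < Δ) (hr : ρ * (U + 2 * β) < L * (r * (τ / M)))
    (hB : ρ * (U + 2 * β) < L * (B * τ)) (hT : n * B * (m + r) + 2 * m ≤ T)
    (hσ0 : 0 < σ) (hσ : 4 * σ ≤ (α - ρ) * L) (hη : U * (τ * (M + 1) ^ m) ≤ σ)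
    (hmσ : ρ * (2 * β / m) ≤ σ) (hΔσ : ρ * Δ ≤ σ)
    (hθ : 4 * β / M ≤ θ) (hθ0 : 0 ≤ θ) (hθU : θ ≤ L + 2 * β)
    (hU2 : 0 < U - L - 2 * β) (hu : 0 < U - 2 * β - U / α)
    (hlog : α * (Real.log (U - L - 2 * β) - Real.log (U - 2 * β - U / α)) = 1)
    (hsmall : α * (2 * Δ + θ) / (U - 2 * β - U / α) < σ / U) : False := by
  have hU : 0 < U := h.L_pos.trans_le h.L_le
  have hβ := h.β_nonneg
  have hLpos := h.L_pos
  have hnΔ : n * Δ = U - L := by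
    rw [hΔ, ← h.mul_δ]; push_cast; ring
  have hn0 : (0 : ℝ) < n := by exact_mod_cast hn
  obtain ⟨us, hus⟩ : ∃ us, us = U - 2 * β - U / α := ⟨_, rfl⟩
  rw [← hus] at hu hlog hsmall
  have hlt : us < U - L - 2 * β := by
    by_contra hcon
    push Not at hcon
    have := Real.log_le_log hU2 hcon
    nlinarith
  -- The first block whose price is at most `U/α`: from here on `U - α(U - iΔ)` is nonnegative.
  obtain ⟨i₀, hi₀⟩ : ∃ i₀, i₀ = ⌈(U - U / α) / Δ⌉₊ := ⟨_, rfl⟩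
  have hi₀pos : 0 < i₀ := by
    rw [hi₀, Nat.ceil_pos]
    exact div_pos (by linarith) hΔ0
  have hi₀n : i₀ ≤ n := by
    rw [hi₀, Nat.ceil_le, div_le_iff₀ hΔ0, hnΔ]
    linarith
  have hi₀ge : U - U / α ≤ i₀ * Δ := by
    rw [← div_le_iff₀ hΔ0, hi₀]
    exact Nat.le_ceil _
  have hi₀lt : i₀ * Δ < U - U / α + Δ := by
    have := Nat.ceil_lt_add_one (show 0 ≤ (U - U / α) / Δ from div_nonneg (by linarith) hΔ0.le)
    rw [← hi₀] at this
    have h2 := mul_lt_mul_of_pos_right this hΔ0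
    rwa [add_mul, div_mul_cancel₀ _ hΔ0.ne', one_mul] at h2
  let Inv : ℕ → ℝ → ℝ → Prop := fun i V F => ∃ p, IsPricePrefix U δ m (i * B) p ∧
    p.length ≤ i * B * (m + r) ∧ b p ≤ τ / M ∧ V ≤ bought a [] p ∧
    -F ≤ priceCost U β a b [] p - U * bought a [] p
  refine no_savings (U := U) (α := α) (σ := σ) (Δ := Δ) (e := θ - 2 * β) (n := n) (i₀ := i₀) Inv
    hα hΔ0 hi₀pos hi₀n (by linarith) (by linarith) ?_ ?_ ?_
  -- The initial potential is at least `σ/U`, which exceeds the error `α(2Δ + θ)/us` from comparing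
  -- the logarithms with those in the equation for `α`.
  · have h1 : σ / U ≤ (U - α * (U - i₀ * Δ) + σ) / (i₀ * Δ + (θ - 2 * β)) := by
      have h2 := mul_le_mul_of_nonneg_left hi₀ge hα.le
      rw [mul_sub, mul_div_cancel₀ _ hα.ne'] at h2
      have h3 : (i₀ : ℝ) * Δ ≤ n * Δ :=
        mul_le_mul_of_nonneg_right (by exact_mod_cast hi₀n) hΔ0.le
      exact div_le_div₀ (by linarith) (by linarith) (by linarith) (by linarith)
    have h4 : Real.log (U - L - 2 * β) ≤ Real.log ((n + 1) * Δ + (θ - 2 * β)) :=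
      Real.log_le_log hU2 (by linarith)
    have h5 : Real.log ((i₀ + 1) * Δ + (θ - 2 * β)) ≤ Real.log us + (2 * Δ + θ) / us := by
      have h6 : Real.log ((i₀ + 1) * Δ + (θ - 2 * β)) ≤ Real.log (us + (2 * Δ + θ)) :=
        Real.log_le_log (by linarith) (by linarith)
      have h7 : Real.log (us + (2 * Δ + θ)) - Real.log us ≤ (2 * Δ + θ) / us := by
        rw [← Real.log_div (by linarith) hu.ne']
        refine (Real.log_le_sub_one_of_pos (div_pos (by linarith) hu)).trans_eq ?_
        field_simp
        ring
      linarith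
    have h8 := mul_le_mul_of_nonneg_left (sub_le_sub h4 h5) hα.le
    rw [mul_div_assoc] at hsmall
    linarith
  · exact ⟨[], by simpa using isPricePrefix_nil, by simp,
      by rw [h.nil]; positivity, by simp [bought, pathSum], by simp [bought, priceCost, pathSum]⟩
  · rintro i hi V F ⟨p, hp, hlen, hbp, hV, hF⟩
    have hmul : (i + 1) * B * (m + r) ≤ n * B * (m + r) :=
      Nat.mul_le_mul_right _ (Nat.mul_le_mul_right _ hi)
    have hmul' : (i + 1) * B * (m + r) = i * B * (m + r) + B * (m + r) := by ring
    have hiB : i * B + B ≤ n * B := by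
      calc i * B + B = (i + 1) * B := by ring
        _ ≤ n * B := Nat.mul_le_mul_right _ hi
    obtain ⟨l', p', v, hl1, hl2, hp', hlen', hb', hv, hpr, hq⟩ := h.exists_quiet_level hp hiB hτ hM
      hr (by omega) hbp (u := (i + 1) * Δ + (θ - 2 * β))
      (by push_cast; rw [hΔ]; linarith) hB
    have hV' : V + v ≤ bought a [] p' := by linarith [hpr.1]
    have hF' : -(F + v * ((i + 1) * Δ + (θ - 2 * β))) ≤
        priceCost U β a b [] p' - U * bought a [] p' := by linarith [hpr.2]
    refine ⟨v, hv, ⟨p', hp'.mono (by nlinarith), by omega, hb', hV', hF'⟩, ?_⟩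
    have hs := h.savings_ge hp' (by omega) (by omega) hV' hF' hq
    refine le_trans ?_ hs
    -- The quiet level lies somewhere in block `i`, which loses up to `ρΔ`. This, the final batch
    -- and OPT's switching cost `σ` each at most; a fourth `σ` remains of `(α - ρ)L`.
    have h1 : (i : ℝ) * Δ ≤ l' * δ := by
      rw [hΔ, ← mul_assoc]
      exact mul_le_mul_of_nonneg_right (by exact_mod_cast hl1) h.δ_nonneg
    have h2 : ρ * (U - l' * δ) ≤ ρ * (U - i * Δ) :=
      mul_le_mul_of_nonneg_left (by linarith) h.ρ_nonneg
    have h3 : L ≤ U - (i + 1) * Δ := by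
      have : ((i : ℝ) + 1) * Δ ≤ n * Δ :=
        mul_le_mul_of_nonneg_right (by exact_mod_cast hi) hΔ0.le
      linarith
    have h4 : 0 < α - ρ := pos_of_mul_pos_left (by linarith only [hσ, hσ0]) hLpos.le
    have h5 := mul_le_mul_of_nonneg_left h3 h4.le
    rw [mul_add]
    linarith only [h2, h5, hσ, hη, hmσ, hΔσ]

end IsCheap

/-! ## Costs of decisions in CFL and the choice of the instances -/

section Vector

variable {ι : Type*} [Fintype ι] [DecidableEq ι]

lemma cfl_hit_nonneg {L U : ℝ} (hL : 0 ≤ L) {w c : ι → ℝ} {k : ι} {q : ℝ} (hq : q ∈ Set.Icc L U)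
    {x : ι → ℝ} (hx : x ∈ (cflProblem w c).decisions) : 0 ≤ cflPriceCost U k q x := by
  rw [cflPriceCost_eq_sum]
  refine Finset.sum_nonneg fun i _ => mul_nonneg ?_ (hx.1 i).1
  split_ifs <;> linarith [hq.1, hq.2]

/-- Buying the same small amount on each of `m` consecutive occurrences of the price `y`. -/
lemma cfl_opt_le {L U β : ℝ} (hL : 0 < L) {w : ι → ℝ} (hw : ∀ i, 0 ≤ w i) {k : ι}
    (hkβ : w k = β) {m : ℕ} (hm : 0 < m) {p q : List ℝ} {y : ℝ}
    (hI : ∀ c ∈ p ++ List.replicate m y ++ q, c ∈ Set.Icc L U) :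
    (cflProblem w fun _ => 1).opt
      ((p ++ List.replicate m y ++ q).map (cflPriceCost U k)) ≤ y + 2 * β / m := by
  obtain ⟨I, hI'⟩ : ∃ I, I = p ++ List.replicate m y ++ q := ⟨_, rfl⟩
  rw [← hI'] at hI ⊢
  have hm0 : (0 : ℝ) < m := by exact_mod_cast hm
  have hβ : 0 ≤ β := hkβ ▸ hw k
  have hlen : (I.map (cflPriceCost U k)).length = p.length + m + q.length := by
    simp [hI', add_assoc]
  -- Holding `1/m` through the batch of price `y` needs only one move in and one move out, each of
  -- cost `β/m`.
  let g : ℕ → ι → ℝ := fun t =>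
    if p.length ≤ t ∧ t < p.length + m then Pi.single k (1 / (m : ℝ)) else 0
  let x : Fin (I.map (cflPriceCost U k)).length → ι → ℝ := fun t => g t
  have hsum : ∀ z : ℝ, ∑ t : Fin (I.map (cflPriceCost U k)).length,
      (if p.length ≤ (t : ℕ) ∧ (t : ℕ) < p.length + m then z / m else 0) = z := by
    intro z
    rw [Fin.sum_univ_eq_sum_range
      (fun t => if p.length ≤ t ∧ t < p.length + m then z / (m : ℝ) else 0), hlen,
      ← Finset.sum_filter]
    have : (Finset.range (p.length + m + q.length)).filter
        (fun t => p.length ≤ t ∧ t < p.length + m) = Finset.Ico p.length (p.length + m) := by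
      ext t; simp; omega
    rw [this, Finset.sum_const, Nat.card_Ico, nsmul_eq_mul, Nat.add_sub_cancel_left]
    field_simp
  have hxdec : ∀ t, x t ∈ (cflProblem w fun _ => 1).decisions := by
    intro t
    have h1 : 1 / (m : ℝ) ≤ 1 := by
      rw [div_le_one hm0]; exact_mod_cast hm
    have h0 : 0 ≤ 1 / (m : ℝ) := by positivity
    simp only [x, g]
    split_ifs
    · refine ⟨fun i => ?_, ?_⟩
      · by_cases h : i = k
        · subst h; simpa using h1
        · simp [h]
      · simpa [Pi.single_apply, apply_ite abs] using h1
    · exact ⟨fun i => by simp, by simp⟩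
  have hfeas : (cflProblem w fun _ => 1).Feasible (I.map (cflPriceCost U k)) x := by
    refine ⟨hxdec, ?_⟩
    refine (hsum 1).ge.trans (Finset.sum_congr rfl fun t _ => ?_).le
    simp only [cflProblem, x, g]
    split_ifs <;> simp [Pi.single_apply, apply_ite abs]
  have hhit : ∑ t, (cflProblem w fun _ => 1).hit ((I.map (cflPriceCost U k)).get t) (x t) = y := by
    rw [← hsum y]
    refine Finset.sum_congr rfl fun t _ => ?_
    simp only [cflProblem, x, g, List.get_eq_getElem, List.getElem_map, cflPriceCost_eq_sum]
    split_ifs with h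
    · have h1 : I[(t : ℕ)]'(by simpa using t.2) = y := by
        simp only [hI']
        rw [List.getElem_append_left (by simp; omega), List.getElem_append_right h.1,
          List.getElem_replicate]
      simp [Pi.single_apply, h1, div_eq_mul_inv]
    · simp
  have hstate : ∀ t, (cflProblem w fun _ => 1).state x t =
      if p.length < t ∧ t ≤ p.length + m then Pi.single k (1 / (m : ℝ)) else 0 := by
    intro t
    unfold OnlineProblem.state
    by_cases h : 0 < t ∧ t ≤ (I.map (cflPriceCost U k)).length
    · rw [dif_pos h]
      simp only [x, g]
      exact if_congr (by omega) rfl rfl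
    · rw [dif_neg h, if_neg (by omega)]
      rfl
  have hmove : ∑ t ∈ Finset.range ((I.map (cflPriceCost U k)).length + 1),
      (cflProblem w fun _ => 1).move ((cflProblem w fun _ => 1).state x t)
        ((cflProblem w fun _ => 1).state x (t + 1)) ≤ 2 * β / m := by
    calc _ ≤ ∑ t ∈ Finset.range ((I.map (cflPriceCost U k)).length + 1),
          ((if t = p.length then β / m else 0) + if t = p.length + m then β / m else 0) := by
          refine Finset.sum_le_sum fun t _ => ?_
          rw [hstate, hstate]
          have h0 : 0 ≤ β / m := by positivity
          have hs : ∀ s : ℝ, (cflProblem w fun _ => 1).move (Pi.single k s) 0 = β * |s| := by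
            intro s
            simp [cflProblem, Pi.single_apply, apply_ite abs, hkβ]
          have hs' : ∀ s : ℝ, (cflProblem w fun _ => 1).move 0 (Pi.single k s) = β * |s| := by
            intro s
            simp [cflProblem, Pi.single_apply, apply_ite abs, hkβ]
          have hs'' : ∀ v : ι → ℝ, (cflProblem w fun _ => 1).move v v = 0 := by
            intro v
            simp [cflProblem]
          have habs : β * |1 / (m : ℝ)| = β / m := by
            rw [abs_of_pos (by positivity)]; ring
          by_cases h1 : p.length < t ∧ t ≤ p.length + m
          · by_cases h2 : p.length < t + 1 ∧ t + 1 ≤ p.length + m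
            · rw [if_pos h1, if_pos h2, hs'']
              positivity
            · rw [if_pos h1, if_neg h2, hs, habs, if_pos (show t = p.length + m by omega)]
              split_ifs <;> linarith
          · by_cases h2 : p.length < t + 1 ∧ t + 1 ≤ p.length + m
            · rw [if_neg h1, if_pos h2, hs', habs, if_pos (show t = p.length by omega)]
              split_ifs <;> linarith
            · rw [if_neg h1, if_neg h2, hs'']
              positivity
      _ = 2 * β / m := by
          rw [Finset.sum_add_distrib, Finset.sum_ite_eq', Finset.sum_ite_eq',
            if_pos (by rw [hlen, Finset.mem_range]; omega),
            if_pos (by rw [hlen, Finset.mem_range]; omega)]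
          ring
  unfold OnlineProblem.opt
  refine le_trans (csInf_le ?_ ⟨x, hfeas, rfl⟩) ?_
  · refine ⟨0, ?_⟩
    rintro _ ⟨z, hz, rfl⟩
    refine add_nonneg (Finset.sum_nonneg fun t _ => ?_) (Finset.sum_nonneg fun t _ => ?_)
    · have hmem : I[(t : ℕ)]'(by simpa using t.2) ∈ I := List.getElem_mem _
      simpa [cflProblem] using cfl_hit_nonneg hL.le (k := k) (hI _ hmem) (hz.1 t)
    · exact Finset.sum_nonneg fun i _ => mul_nonneg (hw i) (abs_nonneg _)
  · exact add_le_add hhit.le hmove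

lemma sum_take_eq_bought (a : List ℝ → ℝ) (p : List ℝ) :
    bought a [] p = ∑ t : Fin p.length, a (p.take (t + 1)) := by
  rw [bought, pathSum_nil_eq_sum]
  refine Finset.sum_congr rfl fun t _ => ?_
  rw [List.get_eq_getElem, List.take_concat_get']

/-- The hitting costs agree exactly; the switching in the other coordinates and the final return to
the origin are dropped. -/
lemma priceCost_le_cost {U : ℝ} {w : ι → ℝ} (hw : ∀ i, 0 ≤ w i) (k : ι)
    {D : List ℝ → ι → ℝ} (hD : D [] = 0) (p : List ℝ) :
    priceCost U (w k) (fun q => ∑ i, D q i) (fun q => D q k) [] p ≤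
      (cflProblem w fun _ => 1).cost (p.map (cflPriceCost U k))
        (fun t => D (p.take ((t : ℕ) + 1))) := by
  have hlen : (p.map (cflPriceCost U k)).length = p.length := by simp
  have hstate : ∀ t ≤ p.length, (cflProblem w fun _ => 1).state
      (fun t : Fin (p.map (cflPriceCost U k)).length => D (p.take ((t : ℕ) + 1))) t =
        D (p.take t) := by
    intro t ht
    unfold OnlineProblem.state
    by_cases h : 0 < t ∧ t ≤ (p.map (cflPriceCost U k)).length
    · rw [dif_pos h]
      simp only
      rw [Nat.sub_add_cancel h.1]
    · rw [dif_neg h, show t = 0 by omega, List.take_zero, hD]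
      rfl
  have hmove : ∀ x y : ι → ℝ, w k * |x k - y k| ≤ (cflProblem w fun _ => 1).move x y :=
    fun x y => Finset.single_le_sum (f := fun i => w i * |x i - y i|)
      (fun i _ => mul_nonneg (hw i) (abs_nonneg _)) (Finset.mem_univ k)
  have hmove0 : ∀ x y : ι → ℝ, 0 ≤ (cflProblem w fun _ => 1).move x y :=
    fun x y => (mul_nonneg (hw k) (abs_nonneg _)).trans (hmove x y)
  rw [priceCost, pathSum_nil_eq_sum, Finset.sum_add_distrib]
  refine add_le_add (le_of_eq ?_) ?_
  · refine Fintype.sum_equiv (finCongr hlen.symm) _ _ fun t => ?_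
    simp only [cflProblem, List.get_eq_getElem, List.take_concat_get', finCongr_apply,
      Fin.val_cast, List.getElem_map]
    rw [cflPriceCost, ← Finset.sum_erase_add _ _ (Finset.mem_univ k), ← Finset.mul_sum]
    ring
  · rw [Finset.sum_range_succ]
    refine le_trans ?_ (le_add_of_nonneg_right (hmove0 _ _))
    rw [show Finset.range (p.map (cflPriceCost U k)).length = Finset.range p.length by rw [hlen],
      ← Fin.sum_univ_eq_sum_range (fun t => (cflProblem w fun _ => 1).move
      ((cflProblem w fun _ => 1).state _ t) ((cflProblem w fun _ => 1).state _ (t + 1)))]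
    refine Finset.sum_le_sum fun t _ => ?_
    rw [hstate _ t.2.le, hstate _ t.2, List.get_eq_getElem, List.take_concat_get']
    exact hmove _ _

end Vector

lemma exists_nat_mul_gt (K : ℕ) (x : ℝ) {y : ℝ} (hy : 0 < y) :
    ∃ n : ℕ, 0 < n ∧ K ≤ n ∧ x < n * y := by
  obtain ⟨n, hn⟩ := exists_nat_gt (x / y)
  refine ⟨max n (max K 1), by omega, by omega, ?_⟩
  rw [← div_lt_iff₀ hy]
  exact hn.trans_le (by exact_mod_cast le_max_left _ _)

/-- Horizon and fineness of instances on which a player with costs at most `ρ (y + 2β / m)` leads to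
a contradiction. -/
lemma exists_not_isCheap {L U β ρ : ℝ} (hL : 0 < L) (hβ : 0 ≤ β) (hβU : β < (U - L) / 2)
    (hρα : ρ < alphaRatio L U β) (N : ℕ) :
    ∃ w m T : ℕ, 0 < w ∧ N ≤ w ∧ 0 < m ∧ N ≤ m ∧
      ∀ a b, ¬ IsCheap L U β ρ ((U - L) / w) w m T a b := by
  have hU : 0 < U := by linarith
  obtain ⟨hα, hu, hlog⟩ := alphaRatio_spec hL hβ hβU
  set α := alphaRatio L U β
  obtain ⟨us, hus⟩ : ∃ us, us = U - 2 * β - U / α := ⟨_, rfl⟩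
  rw [← hus] at hu hlog
  obtain ⟨σ, hσ⟩ : ∃ σ, σ = (α - ρ) * L / 4 := ⟨_, rfl⟩
  have hσ0 : 0 < σ := by
    rw [hσ]
    have : 0 < α - ρ := by linarith
    positivity
  -- The first bound keeps the logarithmic error below `σ/U`, the second keeps the rates of saving
  -- at most `U`.
  obtain ⟨θ, hθ⟩ : ∃ θ, θ = min (σ * us / (4 * U * α)) (L + 2 * β) := ⟨_, rfl⟩
  have hθ0 : 0 < θ := by
    rw [hθ]
    exact lt_min (by positivity) (by linarith)
  have hθ1 : α * (2 * θ) / us < σ / U := by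
    have h1 : θ * (4 * U * α) ≤ σ * us := by
      rw [← le_div_iff₀ (by positivity), hθ]; exact min_le_left _ _
    rw [div_lt_div_iff₀ hu hU]
    linarith [mul_pos hσ0 hu]
  obtain ⟨M, hM0, -, hM⟩ := exists_nat_mul_gt 0 (4 * β) hθ0
  have hM0 : (0 : ℝ) < M := by exact_mod_cast hM0
  obtain ⟨m, hm0, hNm, hm⟩ := exists_nat_mul_gt N (ρ * (2 * β)) hσ0
  have hm0' : (0 : ℝ) < m := by exact_mod_cast hm0
  -- Chosen after `M` and `m`, so that a quiet batch, buying at most `τ (M + 1)^m`, saves at most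
  -- `σ`; `B` and `r` in turn depend on `τ`.
  obtain ⟨τ, hτ⟩ : ∃ τ, τ = σ / (U * (M + 1 : ℝ) ^ m) := ⟨_, rfl⟩
  have hτ0 : 0 < τ := by rw [hτ]; positivity
  obtain ⟨B, hB0, hNB, hB⟩ := exists_nat_mul_gt N (ρ * (U + 2 * β)) (mul_pos hL hτ0)
  obtain ⟨r, -, -, hr⟩ := exists_nat_mul_gt 0 (ρ * (U + 2 * β)) (mul_pos hL (div_pos hτ0 hM0))
  obtain ⟨n₁, hn₁, -, hn₁'⟩ := exists_nat_mul_gt 0 (ρ * (U - L)) hσ0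
  obtain ⟨n, hn, hn1, hn'⟩ := exists_nat_mul_gt n₁ (2 * (U - L)) hθ0
  have hn0 : (0 : ℝ) < n := by exact_mod_cast hn
  have hB0' : (0 : ℝ) < B := by exact_mod_cast hB0
  have hΔ : (U - L) / n = B * ((U - L) / (n * B : ℕ)) := by
    push_cast; field_simp
  have hΔ0 : 0 < (U - L) / n := div_pos (by linarith) hn0
  have hΔσ : ρ * ((U - L) / n) ≤ σ := by
    rw [← mul_div_assoc, div_le_iff₀ hn0]
    have : (n₁ : ℝ) * σ ≤ n * σ := mul_le_mul_of_nonneg_right (by exact_mod_cast hn1) hσ0.le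
    linarith
  have hΔθ : 2 * ((U - L) / n) ≤ θ := by
    rw [← mul_div_assoc, div_le_iff₀ hn0]
    linarith
  -- Each of the `n * B` levels uses at most `m + r` prices; `2 * m` more leave room for the last
  -- batch and for the Up prices after it.
  refine ⟨n * B, m, n * B * (m + r) + 2 * m, by positivity,
    hNB.trans (Nat.le_mul_of_pos_left _ hn), hm0, hNm, fun a b h => ?_⟩
  refine h.false_of_parameters (σ := σ) (θ := θ) (r := r) hα hn hτ0 hM0 hΔ hΔ0 (by linarith)
    (by linarith) le_rfl hσ0 (by rw [hσ]; linarith) ?_ ?_ hΔσ ?_ hθ0.le ?_ (by linarith)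
    (hus ▸ hu) (hus ▸ hlog) ?_
  · rw [hτ]
    refine le_of_eq ?_
    field_simp
  · rw [← mul_div_assoc, div_le_iff₀ hm0']
    linarith
  · rw [div_le_iff₀ hM0]
    linarith
  · rw [hθ]; exact min_le_right _ _
  · rw [← hus]
    refine lt_of_le_of_lt ?_ hθ1
    exact div_le_div_of_nonneg_right (mul_le_mul_of_nonneg_left (by linarith) hα.le) hu.le

/-! ### From competitive algorithms to cheap decisions -/

section Main

variable {ι : Type*} [Fintype ι] [DecidableEq ι]

/-- Decisions that depend on the horizon and on the prices presented so far cannot be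
`ρ`-competitive on the lower-bound instances if `ρ < α`. -/
lemma false_of_competitive {L U β ρ : ℝ} (hL : 0 < L) (hβ : 0 ≤ β) (hβU : β < (U - L) / 2)
    (hρ : 0 ≤ ρ) (hρα : ρ < alphaRatio L U β) {w : ι → ℝ} (hw : ∀ i, 0 ≤ w i) {k : ι}
    (hkβ : w k = β) (N : ℕ) (D : ℕ → List ℝ → ι → ℝ)
    (hfeas : ∀ p ∈ lowerBoundPrices L U N, (cflProblem w fun _ => 1).Feasible
      (p.map (cflPriceCost U k)) (fun t => D p.length (p.take ((t : ℕ) + 1))))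
    (hcost : ∀ p ∈ lowerBoundPrices L U N, ∀ r, 0 ≤ r →
      (cflProblem w fun _ => 1).opt (p.map (cflPriceCost U k)) ≤ r →
      (cflProblem w fun _ => 1).cost
        (p.map (cflPriceCost U k)) (fun t => D p.length (p.take ((t : ℕ) + 1))) ≤ ρ * r) :
    False := by
  classical
  have hLU : L ≤ U := by linarith
  obtain ⟨W, m, T, hW, hNW, hm, hNm, hno⟩ := exists_not_isCheap hL hβ hβU hρα N
  have hW0 : (0 : ℝ) < W := by exact_mod_cast hW
  -- Resetting inadmissible decisions to `0` gives the sign conditions on all lists and the right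
  -- start, and changes nothing on the instances of horizon `T`.
  let D' : List ℝ → ι → ℝ := fun q =>
    if q ≠ [] ∧ D T q ∈ (cflProblem w fun _ => 1).decisions then D T q else 0
  have hD'0 : ∀ q i, 0 ≤ D' q i := by
    intro q i
    simp only [D']
    split_ifs with h
    exacts [(h.2.1 i).1, le_rfl]
  have hD' : ∀ p ∈ lowerBoundPrices L U N, p.length = T →
      ∀ t < p.length, D p.length (p.take (t + 1)) = D' (p.take (t + 1)) := by
    intro p hp hT t ht
    have h1 := (hfeas p hp).1 ⟨t, by simpa using ht⟩
    have hne : p.take (t + 1) ≠ [] := by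
      rw [← List.length_pos_iff, List.length_take]
      omega
    exact (congrArg (D · (p.take (t + 1))) hT).trans (if_pos ⟨hne, hT ▸ h1⟩).symm
  refine hno (fun q => ∑ i, D' q i) (fun q => D' q k) ⟨hL, hLU, hβ, hρ,
    div_nonneg (by linarith) hW0.le, mul_div_cancel₀ _ hW0.ne', hm, by simp [D'],
    fun q => hD'0 q k, fun q => Finset.single_le_sum (f := D' q) (fun i _ => hD'0 q i)
      (Finset.mem_univ k), ?_, ?_⟩
  · intro l hl m' hm' p hp hT
    have hmem := hp.mem_lowerBoundPrices hLU hW hNW hm hNm hl hm'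
    have h1 := (hfeas _ hmem).2
    rw [sum_take_eq_bought]
    refine h1.trans (le_of_eq ?_)
    refine Fintype.sum_equiv (finCongr (by simp)) _ _ fun t => ?_
    beta_reduce
    rw [hD' _ hmem (by simp; omega) t (by simpa using t.2)]
    simp only [cflProblem, one_mul, finCongr_apply, Fin.val_cast]
    exact Finset.sum_congr rfl fun i _ => abs_of_nonneg (hD'0 _ i)
  · intro l hl m' hm' p hp hT
    have hmem := hp.mem_lowerBoundPrices hLU hW hNW hm hNm hl hm'
    have hIcc := (mem_Icc_of_mem_lowerBoundPrices hLU hmem).2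
    have h1 : (0 : ℝ) ≤ U - l * ((U - L) / W) + 2 * β / m := by
      have := (price_mem_Icc hLU hW hl).1
      have : 0 ≤ 2 * β / m := by positivity
      linarith
    have h2 := hcost _ hmem _ h1 (cfl_opt_le hL hw hkβ hm hIcc)
    refine le_trans ?_ h2
    have h3 := priceCost_le_cost (U := U) hw k (D := D') (by simp [D'])
      (p ++ List.replicate m (U - l * ((U - L) / W)) ++ List.replicate m' U)
    rw [hkβ] at h3
    refine h3.trans (le_of_eq ?_)
    congr 1
    funext t
    exact (hD' _ hmem (by simp; omega) t (by simpa using t.2)).symm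

lemma OnlineAlgorithm.run_map {K E : Type*} (A : OnlineAlgorithm K E) (f : ℝ → K) (p : List ℝ)
    (t : Fin (p.map f).length) :
    A.run (p.map f) t = A p.length ((p.take ((t : ℕ) + 1)).map f) :=
  congrArg₂ (fun T q => A T q) (by simp) (by rw [List.map_take])

/-- Comparing with an arbitrary `r ≥ OPT` means that only upper bounds on OPT are needed later. -/
lemma exists_bound_of_competitiveRatio_lt {K E : Type*} {A : OnlineAlgorithm K E}
    {P : OnlineProblem K E} {Ω : Set (List K)} {α : ℝ}
    (h : A.competitiveRatio P Ω < ENNReal.ofReal α) :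
    ∃ ρ, 0 ≤ ρ ∧ ρ < α ∧ ∀ I ∈ Ω, ∀ r, 0 ≤ r → P.opt I ≤ r → P.cost I (A.run I) ≤ ρ * r := by
  obtain ⟨ρ, h1, h2⟩ := ENNReal.lt_iff_exists_nnreal_btwn.1 h
  refine ⟨ρ, ρ.2, ?_, fun I hI r hr hopt => ?_⟩
  · rw [ENNReal.ofReal, ENNReal.coe_lt_coe] at h2
    exact Real.lt_toNNReal_iff_coe_lt.1 h2
  · have h3 : ENNReal.ofReal (P.cost I (A.run I)) / ENNReal.ofReal (P.opt I) ≤ ρ :=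
      (le_iSup₂ (f := fun I (_ : I ∈ Ω) => ENNReal.ofReal (P.cost I (A.run I)) /
        ENNReal.ofReal (P.opt I)) I hI).trans h1.le
    have h4 : (ρ : ℝ≥0∞) ≠ 0 := (bot_le.trans_lt h1).ne'
    rw [ENNReal.div_le_iff_le_mul (Or.inr ENNReal.coe_ne_top) (Or.inr h4)] at h3
    have h5 : ENNReal.ofReal (P.cost I (A.run I)) ≤ ENNReal.ofReal (ρ * r) := by
      refine h3.trans ?_
      rw [ENNReal.ofReal_mul ρ.coe_nonneg, ENNReal.ofReal_coe_nnreal]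
      gcongr
    exact (ENNReal.ofReal_le_ofReal_iff (mul_nonneg ρ.2 hr)).1 h5

end Main

end

theorem corollary3p5 {ι : Type*} [Fintype ι] [DecidableEq ι] (L U β : ℝ) (hL : 0 < L)
    (hβ : 0 ≤ β) (hβU : β < (U - L) / 2) (w : ι → ℝ) (hw : ∀ i, 0 ≤ w i)
    (k : ι) (hk : ∀ i, w i ≤ w k) (hkβ : w k = β) (N : ℕ) :
    -- the lower-bound instances of CFL correspond to instances of MAL on the weighted star
    (∀ p ∈ lowerBoundPrices L U N,
      p.map (cflPriceCost U k) ∈ cflInstances L U β w (fun _ => 1) ∧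
      p.map (malPriceCost U k) ∈ malInstances L U β (starWeight w) none starCon ∧
      Corresponds (malProblem (starWeight w) none starCon) (cflProblem w (fun _ => 1)) forgetOff
        (p.map (malPriceCost U k)) (p.map (cflPriceCost U k))) ∧
    -- they are lower-bound instances for every deterministic online algorithm for CFL
    (∀ A : OnlineAlgorithm ((ι → ℝ) → ℝ) (ι → ℝ),
      A.Solves (cflProblem w (fun _ => 1)) (cflInstances L U β w (fun _ => 1)) →
      ENNReal.ofReal (alphaRatio L U β) ≤
        A.competitiveRatio (cflProblem w (fun _ => 1))
          {I | ∃ p ∈ lowerBoundPrices L U N, I = p.map (cflPriceCost U k)}) ∧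
    -- and so are the corresponding instances for every deterministic online algorithm for MAL
    (∀ A : OnlineAlgorithm (Option ι → ℝ → ℝ) (Option ι → ℝ),
      A.Solves (malProblem (starWeight w) none starCon)
        (malInstances L U β (starWeight w) none starCon) →
      ENNReal.ofReal (alphaRatio L U β) ≤
        A.competitiveRatio (malProblem (starWeight w) none starCon)
          {I | ∃ p ∈ lowerBoundPrices L U N, I = p.map (malPriceCost U k)}) := by
  have hLU : L ≤ U := by linarith
  have hpart : ∀ p ∈ lowerBoundPrices L U N,
      p.map (cflPriceCost U k) ∈ cflInstances L U β w (fun _ => 1) ∧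
      p.map (malPriceCost U k) ∈ malInstances L U β (starWeight w) none starCon ∧
      Corresponds (malProblem (starWeight w) none starCon) (cflProblem w (fun _ => 1)) forgetOff
        (p.map (malPriceCost U k)) (p.map (cflPriceCost U k)) := fun p hp =>
    have h := mem_Icc_of_mem_lowerBoundPrices hLU hp
    ⟨map_mem_cflInstances hw hk hkβ h.1 h.2, map_mem_malInstances hw hk hkβ h.1 h.2,
      corresponds_map hw U k p⟩
  refine ⟨hpart, fun A hA => ?_, fun A hA => ?_⟩
  · by_contra hcon
    obtain ⟨ρ, hρ, hρα, hbound⟩ := exists_bound_of_competitiveRatio_lt (not_le.1 hcon)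
    have hrun : ∀ p : List ℝ, A.run (p.map (cflPriceCost U k)) =
        fun t : Fin (p.map (cflPriceCost U k)).length =>
        A p.length ((p.take ((t : ℕ) + 1)).map (cflPriceCost U k)) := by
      intro p
      funext t
      exact A.run_map _ _ _
    refine false_of_competitive hL hβ hβU hρ hρα hw hkβ N
      (fun T q => A T (q.map (cflPriceCost U k))) (fun p hp => ?_) (fun p hp r hr hopt => ?_)
    · rw [← hrun]
      exact hA _ (hpart p hp).1
    · rw [← hrun]
      exact hbound _ ⟨p, hp, rfl⟩ r hr hopt
  · by_contra hcon
    obtain ⟨ρ, hρ, hρα, hbound⟩ := exists_bound_of_competitiveRatio_lt (not_le.1 hcon)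
    have hstart : (malProblem (starWeight w) none starCon).start ∈
        (malProblem (starWeight w) none starCon).decisions := single_mem_stdSimplex ℝ none
    have hrun : ∀ p (hp : p ∈ lowerBoundPrices L U N),
        (fun t : Fin (p.map (cflPriceCost U k)).length => forgetOff
          (A.run (p.map (malPriceCost U k)) (Fin.cast (hpart p hp).2.2.length_eq.symm t))) =
        fun t : Fin (p.map (cflPriceCost U k)).length =>
          forgetOff (A p.length ((p.take ((t : ℕ) + 1)).map (malPriceCost U k))) := by
      intro p hp
      funext t
      exact congrArg forgetOff (A.run_map _ _ _)
    -- A MAL algorithm with the OFF coordinate forgotten makes CFL decisions of the same cost,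
    -- against the same OPT.
    refine false_of_competitive hL hβ hβU hρ hρα hw hkβ N
      (fun T q => forgetOff (A T (q.map (malPriceCost U k)))) (fun p hp => ?_)
      (fun p hp r hr hopt => ?_)
    · rw [← hrun p hp]
      have hf := hA _ (hpart p hp).2.1
      exact ((hpart p hp).2.2.feasible_iff hf.1).2 hf
    · rw [← hrun p hp, (hpart p hp).2.2.cost_eq hstart (hA _ (hpart p hp).2.1).1]
      exact hbound _ ⟨p, hp, rfl⟩ r hr ((hpart p hp).2.2.opt_eq hstart ▸ hopt)
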